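/- **Setting.** Let $\mathrm{Var}$ be a countably infinite set of variables and $\mathrm{Str}$ the (countable, discrete) set of strings. Fix primitive real-valued functions $f$ and string-valued functions $g$ with measurable interpretations $[\![f]\!]:\mathbb R^n\to\mathbb R$ and $[\![g]\!]:\mathrm{Str}^m\times\mathbb R^l\to\mathrm{Str}$. Consider the language $$E::=c\mid x\mid f(E,\dots,E),\quad B::=\mathsf{true}\mid E<E\mid B\wedge B\mid\neg B,\quad S::=\alpha\mid g(S,\dots,S,E,\dots,E),$$ $$C::=\mathsf{skip}\mid x:=E\mid C;C\mid \mathsf{if}\,B\,\{C\}\,\mathsf{else}\,\{C\}\mid\mathsf{while}\,B\,\{C\}\mid x:=\mathsf{sample}(S,E,E)\mid\mathsf{score}(E,E,E).$$ A store is a map $s:\mathrm{Var}\to\mathbb R$ (product $\sigma$-algebra); a random database is a map $r:K\to\mathbb R$ with $K=\mathrm{dom}(r)\subseteq\mathrm{Str}$ finite, and $\mathrm{Rdb}=\bigcup_{K}[K\to\mathbb R]$ carries the disjoint-union $\sigma$-algebra; $[]$ is the empty database; a state is $\sigma=(\sigma_s,\sigma_r)\in\mathrm{State}=\mathrm{Store}\times\mathrm{Rdb}$.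 Expressions have the usual meaning as functions of the store. Write $r\# r'$ if $\mathrm{dom}(r)\cap\mathrm{dom}(r')=\emptyset$, and $r\uplus r'$ for the merge. The reference measure is $\rho(R)=\sum_{K}\lambda^{K}(R\cap[K\to\mathbb R])$, with $\lambda^K$ Lebesgue measure on $[K\to\mathbb R]$. Let $\mathcal N(v;m,d)$ be the normal density with mean $m$ and standard deviation $d$. **Measure semantics.** $[\![C]\!]$ is a subprobability kernel from $\mathrm{State}$ to $\mathrm{State}\times[0,\infty)$ (final state, score). At $\sigma$: $\mathsf{skip}$ and $x:=E$ give the Dirac measures at $(\sigma,1)$ and $(\sigma[x\mapsto[\![E]\!]\sigma_s],1)$; $C_0;C_1$ draws $(\sigma',w')$ from $[\![C_0]\!](\sigma)$, then $(\sigma'',w'')$ from $[\![C_1]\!](\sigma')$, and returns $(\sigma'',w'w'')$; conditionals select a branch; $\mathsf{while}\,B\,\{C\}$ is the least fixed point of $\kappa\mapsto$ (if $B$ then $[\![C]\!];\kappa$ else $\mathsf{skip}$), for the setwise order of kernels; $x:=\mathsf{sample}(S,E_1,E_2)$ is the zero measure if $[\![S]\!]\sigma_s\in\mathrm{dom}(\sigma_r)$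 or $[\![E_2]\!]\sigma_s\le0$, and otherwise the law of $((\sigma_s[x\mapsto v],\sigma_r[[\![S]\!]\sigma_s\mapsto v]),1)$ with $v$ normal with mean $[\![E_1]\!]\sigma_s$ and standard deviation $[\![E_2]\!]\sigma_s$; $\mathsf{score}(E_0,E_1,E_2)$ is the zero measure if $[\![E_2]\!]\sigma_s\le 0$, and otherwise the Dirac measure at $(\sigma,\mathcal N([\![E_0]\!]\sigma_s;[\![E_1]\!]\sigma_s,[\![E_2]\!]\sigma_s))$. **Density semantics.** $[\![C]\!]_d$ is a function $\mathrm{Store}\times\mathrm{Rdb}\to\{\bot\}\cup(\mathrm{Store}\times\mathrm{Rdb}\times[0,\infty)\times[0,\infty))$ that is measurable and local; a measurable $g$ is *local* if $g(s,r)=(s',r',w',p')$ implies that $r=r'\uplus r''$ and $g(s,r'')=(s',[],w',p')$ for some $r''\# r'$, and that $g(s,r\uplus t)=(s',r'\uplus t,w',p')$ for all $t\# r$. At $(s,r)$: $\mathsf{skip}$ gives $(s,r,1,1)$; $x:=E$ gives $(s[x\mapsto[\![E]\!]s],r,1,1)$; $C_0;C_1$ runs $[\![C_0]\!]_d$ and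 then $[\![C_1]\!]_d$ on the resulting store and database, propagating $\bot$ and multiplying the last two components; conditionals select a branch; $\mathsf{while}\,B\,\{C\}$ is the least fixed point of $g\mapsto$ (if $B$ then $[\![C]\!]_d;g$ else $\mathsf{skip}$) among measurable local functions with the pointwise flat order; $x:=\mathsf{sample}(S,E_1,E_2)$ gives $\bot$ if $\alpha:=[\![S]\!]s\notin\mathrm{dom}(r)$ or $[\![E_2]\!]s\le0$, and otherwise $(s[x\mapsto r(\alpha)],r\setminus\alpha,1,\mathcal N(r(\alpha);[\![E_1]\!]s,[\![E_2]\!]s))$; $\mathsf{score}(E_0,E_1,E_2)$ gives $\bot$ if $[\![E_2]\!]s\le0$, and otherwise $(s,r,\mathcal N([\![E_0]\!]s;[\![E_1]\!]s,[\![E_2]\!]s),1)$. If $[\![C]\!]_d(s,r)=(s',[],w',p')$, put $\mathrm{dens}(C,s)(r)=w'p'$ and $\mathrm{get}(C,s)(r)=s'$; in every other case put $\mathrm{dens}(C,s)(r)=0$ and $\mathrm{get}(C,s)(r)=\bot$. **Theorem.** Let $C$ be a command. 1. For every state $\sigma$ and every non-negative bounded measurable $h:(\{\bot\}\cup\mathrm{Store})\times\mathrm{Rdb}\to\mathbb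 R$ that is monotone for the order $(a,r)\sqsubseteq(a',r')\iff(a=\bot\vee a=a')\wedge r=r'$, the integrand on the right below is measurable in $r'$ and, as an equality in $[0,\infty]$, $$\int[\![C]\!](\sigma)(d(\sigma',w'))\;w'\,h(\sigma'_s,\sigma'_r)=\int\rho(dr')\;\mathrm{dens}(C,\sigma_s)(r')\cdot\mathbf 1[r'\#\sigma_r]\cdot h\big(\mathrm{get}(C,\sigma_s)(r'),\,r'\uplus\sigma_r\big).$$ 2. For every initial store $s_I$, the function $\mathrm{dens}(C,s_I)$ is measurable and is the density with respect to $\rho$ of the unnormalised posterior $\mathrm{Meas}(C,A):=\int[\![C]\!]((s_I,[]))(d(\sigma,w))\;w\cdot\mathbf 1[\sigma\in\mathrm{Store}\times A]$; that is, for every measurable $A\subseteq\mathrm{Rdb}$, $$\mathrm{Meas}(C,A)=\int\rho(dr)\;\mathbf 1[r\in A]\cdot\mathrm{dens}(C,s_I)(r).$$ -/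

import Mathlib

open MeasureTheory ProbabilityTheory OmegaCompletePartialOrder
open scoped NNReal ENNReal

namespace ProbLang

/-! ## Measurable spaces -/

/-- Strings carry the discrete sigma-algebra. -/
instance instMeasurableSpaceString : MeasurableSpace String := ⊤

instance instDiscreteString : DiscreteMeasurableSpace String := ⟨fun _ => trivial⟩

instance instCountableString : Countable String :=
  haveI : Countable Char :=
    Function.Injective.countable (f := fun c : Char => c.val.toNat) fun _ _ h =>
      Char.ext (UInt32.toNat_inj.1 h)
  Function.Injective.countable (f := String.toList) fun _ _ h => String.toList_injective h

/-- `Option α` stands for the disjoint union `{⊥} ∪ α`, with `⊥` written `none`; a subset is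
measurable iff its trace on `α` is measurable (every subset of `{⊥}` is). -/
instance instMeasurableSpaceOption {α : Type*} [m : MeasurableSpace α] :
    MeasurableSpace (Option α) := m.map some

/-- The flat order on `{⊥} ∪ α`. -/
def FlatLE {α : Type*} (a b : Option α) : Prop := a = none ∨ a = b

/-- Stores: maps from variables to reals, with the product sigma-algebra. -/
abbrev Store (Var : Type*) := Var → ℝ

/-- Random databases: the disjoint union of the spaces `K → ℝ` over finite sets `K` of strings,
with the disjoint-union sigma-algebra. -/
abbrev Rdb := Σ K : Finset String, (K → ℝ)

/-- States: a store together with a random database. -/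
abbrev State (Var : Type*) := Store Var × Rdb

namespace Rdb

/-- The domain of a random database. -/
def dom (r : Rdb) : Finset String := r.1

/-- The value of `r` at `α`, if `α` belongs to the domain of `r`. -/
def lookup (r : Rdb) (α : String) : Option ℝ :=
  if h : α ∈ r.1 then some (r.2 ⟨α, h⟩) else none

/-- The empty random database `[]`. -/
def empty : Rdb := ⟨∅, fun _ => 0⟩

/-- `r[α ↦ v]`. -/
def insert (r : Rdb) (α : String) (v : ℝ) : Rdb :=
  ⟨Insert.insert α r.1, fun β => if β.1 = α then v else (lookup r β.1).getD 0⟩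

/-- `r \ α`: remove the entry `α` if there is one. -/
def erase (r : Rdb) (α : String) : Rdb :=
  ⟨r.1.erase α, fun β => r.2 ⟨β.1, Finset.mem_of_mem_erase β.2⟩⟩

/-- `r # r'`: the domains of `r` and `r'` are disjoint. -/
def Disj (r r' : Rdb) : Prop := dom r ∩ dom r' = ∅

/-- `r ⊎ r'`, the merge of `r` and `r'`, with priority to `r`. -/
def union (r r' : Rdb) : Rdb :=
  ⟨r.1 ∪ r'.1, fun β => if h : β.1 ∈ r.1 then r.2 ⟨β.1, h⟩ else (lookup r' β.1).getD 0⟩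

/-- The reference measure `ρ`: the sum over all finite `K` of Lebesgue measure on `K → ℝ`. -/
noncomputable def refMeasure : Measure Rdb :=
  Measure.sum fun K : Finset String =>
    (Measure.pi fun _ : K => (volume : Measure ℝ)).map fun u => (⟨K, u⟩ : Rdb)

end Rdb

/-- The density at `v` of the normal distribution with mean `m` and standard deviation `s`. -/
noncomputable def normalDensity (v m s : ℝ) : ℝ≥0 :=
  (gaussianPDFReal m (s ^ 2).toNNReal v).toNNReal

/-! ## Measurability facts -/

section Measurability

theorem measurable_some {α : Type*} [MeasurableSpace α] : Measurable (some : α → Option α) :=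
  fun _ h => h

theorem measurable_of_option {α X Y : Type*} [MeasurableSpace α] [MeasurableSpace X]
    [MeasurableSpace Y] [Nonempty Y] {f : X × Option Y → α}
    (h0 : Measurable fun x => f (x, none)) (h1 : Measurable fun p : X × Y => f (p.1, some p.2)) :
    Measurable f := by
  classical
  obtain ⟨y0⟩ := ‹Nonempty Y›
  have hS : MeasurableSet {o : Option Y | o = none} := by
    change MeasurableSet (some ⁻¹' {o : Option Y | o = none})
    simp [Set.preimage]
  have hg : Measurable fun o : Option Y => o.getD y0 := by
    intro A hA
    change MeasurableSet (some ⁻¹' _)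
    exact hA
  have : f = fun p => if p.2 = none then f (p.1, none) else f (p.1, some (p.2.getD y0)) := by
    funext ⟨x, o⟩
    cases o <;> simp
  rw [this]
  exact Measurable.ite (measurable_snd hS) (h0.comp measurable_fst)
    (h1.comp (measurable_fst.prodMk (hg.comp measurable_snd)))

theorem measurable_of_option' {α Y : Type*} [MeasurableSpace α] [MeasurableSpace Y]
    {f : Option Y → α} (h1 : Measurable fun y => f (some y)) : Measurable f :=
  fun _ hA => h1 hA

theorem measurable_option_iff {X Y : Type*} [MeasurableSpace X] [MeasurableSpace Y]
    {f : X → Option Y} :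
    Measurable f ↔ ∀ A : Set Y, MeasurableSet A → MeasurableSet {x | ∃ y ∈ A, f x = some y} := by
  have key : ∀ A : Set (Option Y),
      f ⁻¹' A = {x | ∃ y ∈ some ⁻¹' A, f x = some y} ∪
        ({x | ∃ y ∈ Set.univ, f x = some y}ᶜ ∩ {_x | none ∈ A}) := by
    intro A
    ext x
    rcases hx : f x with _ | y <;> simp [hx]
  constructor
  · intro h A hA
    have : {x | ∃ y ∈ A, f x = some y} = f ⁻¹' (some '' A) := by
      ext x
      simp [eq_comm]
    rw [this]
    apply h
    change MeasurableSet (some ⁻¹' _)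
    rwa [Set.preimage_image_eq _ (Option.some_injective Y)]
  · intro h A hA
    rw [key]
    exact (h _ hA).union ((h _ MeasurableSet.univ).compl.inter (MeasurableSet.const _))

theorem measurable_sigmaMk (K : Finset String) :
    Measurable fun u : K → ℝ => (⟨K, u⟩ : Rdb) :=
  fun _ hA => (MeasurableSpace.measurableSet_iInf.1 hA) K

theorem measurable_of_rdb' {α : Type*} [MeasurableSpace α] {f : Rdb → α}
    (h : ∀ K : Finset String, Measurable fun u : K → ℝ => f ⟨K, u⟩) : Measurable f :=
  fun _ hA => MeasurableSpace.measurableSet_iInf.2 fun K => h K hA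

theorem measurable_of_rdb {α X : Type*} [MeasurableSpace α] [MeasurableSpace X]
    {f : X × Rdb → α}
    (h : ∀ K : Finset String, Measurable fun p : X × (K → ℝ) => f (p.1, ⟨K, p.2⟩)) :
    Measurable f := by
  have hproj : ∀ K : Finset String,
      Measurable fun (r : Rdb) (a : K) => (Rdb.lookup r a.1).getD 0 := by
    intro K
    refine measurable_pi_lambda _ fun a => measurable_of_rdb' fun K' => ?_
    by_cases ha : a.1 ∈ K'
    · simpa [Rdb.lookup, ha] using measurable_pi_apply (⟨a.1, ha⟩ : K')
    · simp [Rdb.lookup, ha]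
  have hfst : ∀ K : Finset String, MeasurableSet {r : Rdb | r.1 = K} := fun K =>
    MeasurableSpace.measurableSet_iInf.2 fun K' => by
      change MeasurableSet {_u : K' → ℝ | K' = K}
      exact MeasurableSet.const _
  intro A hA
  have : f ⁻¹' A = ⋃ K : Finset String, {p : X × Rdb | p.2.1 = K} ∩
      (fun p : X × Rdb =>
        f (p.1, (⟨K, fun a : K => (Rdb.lookup p.2 a.1).getD 0⟩ : Rdb))) ⁻¹' A := by
    ext ⟨x, K, u⟩
    simp [Rdb.lookup]
  rw [this]
  exact MeasurableSet.iUnion fun K => (measurable_snd (hfst K)).inter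
    (((h K).comp (measurable_fst.prodMk ((hproj K).comp measurable_snd))) hA)

theorem measurable_lookup : Measurable fun p : String × Rdb => Rdb.lookup p.2 p.1 := by
  refine measurable_from_prod_countable_right fun α => measurable_of_rdb' fun K => ?_
  by_cases ha : α ∈ K
  · simpa [Rdb.lookup, ha, Function.comp_def] using measurable_some.comp (measurable_pi_apply (⟨α, ha⟩ : K))
  · simp [Rdb.lookup, ha]

theorem measurable_insert :
    Measurable fun p : String × (ℝ × Rdb) => Rdb.insert p.2.2 p.1 p.2.1 := by
  refine measurable_from_prod_countable_right fun α => measurable_of_rdb fun K => ?_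
  have h : Measurable fun (p : ℝ × (K → ℝ)) (β : (Insert.insert α K : Finset String)) =>
      if β.1 = α then p.1 else (Rdb.lookup ⟨K, p.2⟩ β.1).getD 0 := by
    refine measurable_pi_lambda _ fun β => ?_
    by_cases hb : β.1 = α
    · simpa [hb] using measurable_fst
    · have hK : β.1 ∈ K := (Finset.mem_insert.1 β.2).resolve_left hb
      simpa [hb, Rdb.lookup, hK, Function.comp_def] using
        (measurable_pi_apply (⟨β.1, hK⟩ : K)).comp measurable_snd
  exact (measurable_sigmaMk _).comp h

theorem measurable_erase : Measurable fun p : String × Rdb => Rdb.erase p.2 p.1 := by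
  refine measurable_from_prod_countable_right fun α => measurable_of_rdb' fun K => ?_
  have h : Measurable fun (u : K → ℝ) (β : K.erase α) =>
      u ⟨β.1, Finset.mem_of_mem_erase β.2⟩ :=
    measurable_pi_lambda _ fun β => measurable_pi_apply _
  exact (measurable_sigmaMk _).comp h

theorem measurable_normalDensity :
    Measurable fun p : ℝ × ℝ × ℝ => normalDensity p.1 p.2.1 p.2.2 := by
  have h : Measurable fun p : ℝ × ℝ × ℝ => (p.2.1, (p.2.2 ^ 2).toNNReal, p.1) := by fun_prop
  exact (measurable_uncurry_gaussianPDFReal.comp h).real_toNNReal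

theorem measurable_normalDensity_comp {X : Type*} [MeasurableSpace X] {f g h : X → ℝ}
    (hf : Measurable f) (hg : Measurable g) (hh : Measurable h) :
    Measurable fun x => normalDensity (f x) (g x) (h x) := by
  have := measurable_normalDensity.comp (hf.prodMk (hg.prodMk hh))
  simpa only [Function.comp_def] using this

end Measurability

/-! ## Syntax -/

/-- The primitive real-valued functions and string-valued functions of the language, with their
arities and their (measurable) interpretations. -/
structure Primitives.{u} where
  /-- names of real-valued primitives -/
  RFun : Type u
  /-- a real-valued primitive `f` takes `arity f` reals -/
  arity : RFun → ℕ
  /-- interpretation of real-valued primitives -/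
  rfun : ∀ f, (Fin (arity f) → ℝ) → ℝ
  measurable_rfun : ∀ f, Measurable (rfun f)
  /-- names of string-valued primitives -/
  SFun : Type u
  /-- a string-valued primitive `g` takes `sArity g` strings and `rArity g` reals -/
  sArity : SFun → ℕ
  /-- number of real arguments of a string-valued primitive -/
  rArity : SFun → ℕ
  /-- interpretation of string-valued primitives -/
  sfun : ∀ g, (Fin (sArity g) → String) × (Fin (rArity g) → ℝ) → String
  measurable_sfun : ∀ g, Measurable (sfun g)

/-- Real expressions `E ::= c | x | f(E,…,E)`. -/
inductive RExp (P : Primitives) (Var : Type*)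
  | const (c : ℝ)
  | var (x : Var)
  | app (f : P.RFun) (args : Fin (P.arity f) → RExp P Var)

/-- Boolean expressions `B ::= true | E < E | B ∧ B | ¬ B`. -/
inductive BExp (P : Primitives) (Var : Type*)
  | tt
  | lt (E₀ E₁ : RExp P Var)
  | and (B₀ B₁ : BExp P Var)
  | not (B : BExp P Var)

/-- String expressions `S ::= α | g(S,…,S,E,…,E)`. -/
inductive SExp (P : Primitives) (Var : Type*)
  | const (α : String)
  | app (g : P.SFun) (sargs : Fin (P.sArity g) → SExp P Var)
      (rargs : Fin (P.rArity g) → RExp P Var)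

/-- Commands. -/
inductive Cmd (P : Primitives) (Var : Type*)
  /-- `skip` -/
  | skip
  /-- `x := E` -/
  | assign (x : Var) (E : RExp P Var)
  /-- `C₀; C₁` -/
  | seq (C₀ C₁ : Cmd P Var)
  /-- `if B {C₀} else {C₁}` -/
  | ite (B : BExp P Var) (C₀ C₁ : Cmd P Var)
  /-- `while B {C}` -/
  | while (B : BExp P Var) (C : Cmd P Var)
  /-- `x := sample_norm(S, E₁, E₂)` -/
  | sample (x : Var) (S : SExp P Var) (E₁ E₂ : RExp P Var)
  /-- `score_norm(E₀, E₁, E₂)` -/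
  | score (E₀ E₁ E₂ : RExp P Var)

section Expressions

variable {P : Primitives} {Var : Type*}

/-- The meaning of a real expression in a store. -/
def RExp.eval : RExp P Var → Store Var → ℝ
  | .const c, _ => c
  | .var x, s => s x
  | .app f args, s => P.rfun f fun i => (args i).eval s

/-- The meaning of a Boolean expression in a store. -/
noncomputable def BExp.eval : BExp P Var → Store Var → Bool
  | .tt, _ => true
  | .lt E₀ E₁, s => decide (E₀.eval s < E₁.eval s)
  | .and B₀ B₁, s => B₀.eval s && B₁.eval s
  | .not B, s => !(B.eval s)

/-- The meaning of a string expression in a store. -/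
def SExp.eval : SExp P Var → Store Var → String
  | .const α, _ => α
  | .app g sargs rargs, s =>
      P.sfun g (fun i => (sargs i).eval s, fun i => (rargs i).eval s)

theorem RExp.measurable_eval (E : RExp P Var) : Measurable E.eval := by
  induction E with
  | const c => exact measurable_const
  | var x => exact measurable_pi_apply x
  | app f args ih => exact (P.measurable_rfun f).comp (measurable_pi_lambda _ ih)

theorem SExp.measurable_eval (S : SExp P Var) : Measurable S.eval := by
  induction S with
  | const c => exact measurable_const
  | app g sargs rargs ih =>
    exact (P.measurable_sfun g).comp ((measurable_pi_lambda _ ih).prodMk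
      (measurable_pi_lambda _ fun i => (rargs i).measurable_eval))

theorem BExp.measurable_eval (B : BExp P Var) : Measurable B.eval := by
  induction B with
  | tt => exact measurable_const
  | lt E₀ E₁ =>
    refine measurable_to_bool ?_
    have : (BExp.lt E₀ E₁).eval ⁻¹' {true} = {s | E₀.eval s < E₁.eval s} := by
      ext s
      simp [BExp.eval]
    rw [this]
    exact measurableSet_lt E₀.measurable_eval E₁.measurable_eval
  | and B₀ B₁ h₀ h₁ =>
    exact (measurable_of_countable fun b : Bool × Bool => b.1 && b.2).comp (h₀.prodMk h₁)
  | not B h => exact (measurable_of_countable Bool.not).comp h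

end Expressions

/-! ## Least fixed points -/

section Fix

variable {α : Type*} [OmegaCompletePartialOrder α] [OrderBot α]

/-- The least fixed point of a continuous function: the limit of `⊥ ⊑ F ⊥ ⊑ F (F ⊥) ⊑ …`. -/
def fix (F : α →𝒄 α) : α := ωSup (fixedPoints.iterateChain (F : α →o α) ⊥ bot_le)

theorem isLeast_fix (F : α →𝒄 α) : IsLeast (Function.fixedPoints F) (fix F) :=
  ⟨fixedPoints.ωSup_iterate_mem_fixedPoint F ⊥ bot_le,
    fun _ h => fixedPoints.ωSup_iterate_le_fixedPoint F ⊥ bot_le h bot_le⟩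

end Fix

/-! ## Measure semantics -/

/-- The set `𝒦` of subprobability kernels from states to states paired with a score. -/
structure SubKernel (Var : Type*) where
  /-- the underlying kernel -/
  ker : Kernel (State Var) (State Var × ℝ≥0)
  le_one : ∀ σ, ker σ Set.univ ≤ 1

namespace SubKernel

variable {Var : Type*}

instance (κ : SubKernel Var) : IsFiniteKernel κ.ker := ⟨⟨1, ENNReal.one_lt_top, κ.le_one⟩⟩

theorem ext_apply {κ κ' : SubKernel Var}
    (h : ∀ σ A, MeasurableSet A → κ.ker σ A = κ'.ker σ A) : κ = κ' := by
  obtain ⟨k, _⟩ := κ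
  obtain ⟨k', _⟩ := κ'
  have : k = k' := Kernel.ext fun σ => Measure.ext (h σ)
  subst this
  rfl

/-- `κ ⊑ κ'` iff `κ(σ)(A) ≤ κ'(σ)(A)` for all states `σ` and measurable `A`. -/
instance : PartialOrder (SubKernel Var) where
  le κ κ' := ∀ σ A, MeasurableSet A → κ.ker σ A ≤ κ'.ker σ A
  le_refl _ _ _ _ := le_rfl
  le_trans _ _ _ h h' σ A hA := (h σ A hA).trans (h' σ A hA)
  le_antisymm _ _ h h' := ext_apply fun σ A hA => le_antisymm (h σ A hA) (h' σ A hA)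

/-- The least element is the zero kernel. -/
noncomputable instance : OrderBot (SubKernel Var) where
  bot := ⟨0, fun σ => by simp⟩
  bot_le κ σ A _ := by
    change (0 : Kernel (State Var) (State Var × ℝ≥0)) σ A ≤ _
    simp

/-- The measure `A ↦ sup_n κ_n(σ)(A)` for an increasing sequence of kernels. -/
noncomputable def supMeasure (c : Chain (SubKernel Var)) (σ : State Var) :
    Measure (State Var × ℝ≥0) :=
  Measure.ofMeasurable (fun A _ => ⨆ n, (c n).ker σ A) (by simp) (by
    intro f hf hd
    have hm : ∀ i, Monotone fun n => (c n).ker σ (f i) :=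
      fun i n m h => c.monotone h σ (f i) (hf i)
    calc ⨆ n, (c n).ker σ (⋃ i, f i) = ⨆ n, ∑' i, (c n).ker σ (f i) :=
          iSup_congr fun n => measure_iUnion hd hf
      _ = ⨆ n, ∫⁻ i, (c n).ker σ (f i) ∂Measure.count :=
          iSup_congr fun n => (lintegral_count _).symm
      _ = ∫⁻ i, ⨆ n, (c n).ker σ (f i) ∂Measure.count :=
          (lintegral_iSup (fun n => measurable_of_countable _) fun n m h i => hm i h).symm
      _ = ∑' i, ⨆ n, (c n).ker σ (f i) := lintegral_count _)

theorem supMeasure_apply (c : Chain (SubKernel Var)) (σ : State Var)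
    {A : Set (State Var × ℝ≥0)} (hA : MeasurableSet A) :
    supMeasure c σ A = ⨆ n, (c n).ker σ A :=
  Measure.ofMeasurable_apply A hA

/-- Least upper bounds of increasing sequences are taken setwise. -/
noncomputable instance : OmegaCompletePartialOrder (SubKernel Var) where
  ωSup c :=
    { ker := ⟨supMeasure c, Measure.measurable_of_measurable_coe _ fun A hA => by
        simp only [supMeasure_apply c _ hA]
        exact Measurable.iSup fun n => Kernel.measurable_coe _ hA⟩
      le_one := fun σ => by
        change supMeasure c σ Set.univ ≤ 1
        rw [supMeasure_apply c σ MeasurableSet.univ]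
        exact iSup_le fun n => (c n).le_one σ }
  le_ωSup c n σ A hA := by
    change _ ≤ supMeasure c σ A
    rw [supMeasure_apply c σ hA]
    exact le_iSup (fun n => (c n).ker σ A) n
  ωSup_le c κ h σ A hA := by
    change supMeasure c σ A ≤ _
    rw [supMeasure_apply c σ hA]
    exact iSup_le fun n => h n σ A hA

theorem ωSup_apply (c : Chain (SubKernel Var)) (σ : State Var)
    {A : Set (State Var × ℝ≥0)} (hA : MeasurableSet A) :
    (ωSup c).ker σ A = ⨆ n, (c n).ker σ A :=
  supMeasure_apply c σ hA

/-- The kernel that returns the state `f σ` with score `w σ` (a Dirac measure). -/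
noncomputable def ret (f : State Var → State Var × ℝ≥0) (hf : Measurable f) : SubKernel Var :=
  ⟨Kernel.deterministic f hf, fun σ => by simp⟩

/-- Continue from a state that already carries a score: run `κ` from `σ'` and multiply the
resulting score by `w'`. -/
noncomputable def lift (κ : SubKernel Var) :
    Kernel (State Var × ℝ≥0) (State Var × ℝ≥0) where
  toFun p := (κ.ker p.1).map fun q => (q.1, p.2 * q.2)
  measurable' := by
    refine Measure.measurable_of_measurable_coe _ fun A hA => ?_
    have hB : MeasurableSet
        ((fun z : (State Var × ℝ≥0) × (State Var × ℝ≥0) => (z.2.1, z.1.2 * z.2.2)) ⁻¹' A) := by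
      have : Measurable
          fun z : (State Var × ℝ≥0) × (State Var × ℝ≥0) => (z.2.1, z.1.2 * z.2.2) := by
        fun_prop
      exact this hA
    have h := Kernel.measurable_kernel_prodMk_left
      (κ := κ.ker.comap (Prod.fst : State Var × ℝ≥0 → State Var) measurable_fst) hB
    convert h using 2 with p
    rw [Measure.map_apply (by fun_prop) hA]
    rfl

/-- Sequential composition: from `σ`, draw `(σ', w')` from `κ₀ σ`, then `(σ'', w'')` from
`κ₁ σ'`, and return `(σ'', w' * w'')`. -/
noncomputable def seq (κ₀ κ₁ : SubKernel Var) : SubKernel Var where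
  ker := lift κ₁ ∘ₖ κ₀.ker
  le_one σ := by
    rw [Kernel.comp_apply' _ _ _ MeasurableSet.univ]
    calc ∫⁻ p, lift κ₁ p Set.univ ∂κ₀.ker σ ≤ ∫⁻ _p, 1 ∂κ₀.ker σ := by
          refine lintegral_mono fun p => ?_
          change (κ₁.ker p.1).map (fun q => (q.1, p.2 * q.2)) Set.univ ≤ 1
          rw [Measure.map_apply (by fun_prop) MeasurableSet.univ]
          exact κ₁.le_one _
      _ ≤ 1 := by simpa using κ₀.le_one σ

theorem lift_apply (κ : SubKernel Var) (p : State Var × ℝ≥0) {A : Set (State Var × ℝ≥0)}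
    (hA : MeasurableSet A) :
    lift κ p A = κ.ker p.1 ((fun q => (q.1, p.2 * q.2)) ⁻¹' A) :=
  Measure.map_apply (by fun_prop) hA

theorem seq_apply (κ₀ κ₁ : SubKernel Var) (σ : State Var) {A : Set (State Var × ℝ≥0)}
    (hA : MeasurableSet A) :
    (seq κ₀ κ₁).ker σ A =
      ∫⁻ p, ∫⁻ q, A.indicator 1 (q.1, p.2 * q.2) ∂κ₁.ker p.1 ∂κ₀.ker σ := by
  change (lift κ₁ ∘ₖ κ₀.ker) σ A = _
  rw [Kernel.comp_apply' _ _ _ hA]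
  refine lintegral_congr fun p => ?_
  have hm : Measurable fun q : State Var × ℝ≥0 => (q.1, p.2 * q.2) := by fun_prop
  rw [lift_apply κ₁ p hA, ← lintegral_indicator_one (hm hA)]
  rfl

theorem measurableSet_true {b : Store Var → Bool} (hb : Measurable b) :
    MeasurableSet {σ : State Var | b σ.1 = true} :=
  (hb.comp measurable_fst) (measurableSet_singleton true)

/-- Branch on a measurable Boolean function of the store. -/
noncomputable def cond (b : Store Var → Bool) (hb : Measurable b) (κ₀ κ₁ : SubKernel Var) :
    SubKernel Var where
  ker := Kernel.piecewise (measurableSet_true hb) κ₀.ker κ₁.ker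
  le_one σ := by
    rw [Kernel.piecewise_apply]
    split_ifs
    exacts [κ₀.le_one σ, κ₁.le_one σ]

theorem cond_apply (b : Store Var → Bool) (hb : Measurable b) (κ₀ κ₁ : SubKernel Var)
    (σ : State Var) :
    (cond b hb κ₀ κ₁).ker σ = if b σ.1 = true then κ₀.ker σ else κ₁.ker σ :=
  Kernel.piecewise_apply (hs := measurableSet_true hb) σ

/-- The loop functional `κ ↦ if B then (κ₀; κ) else skip`. -/
noncomputable def loop (b : Store Var → Bool) (hb : Measurable b) (κ₀ : SubKernel Var) :
    SubKernel Var →𝒄 SubKernel Var where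
  toFun κ := cond b hb (seq κ₀ κ) (ret (fun σ => (σ, 1)) (by fun_prop))
  monotone' κ κ' h σ A hA := by
    rw [cond_apply, cond_apply]
    split_ifs
    · change (lift κ ∘ₖ κ₀.ker) σ A ≤ (lift κ' ∘ₖ κ₀.ker) σ A
      rw [Kernel.comp_apply' _ _ _ hA, Kernel.comp_apply' _ _ _ hA]
      refine lintegral_mono fun p => ?_
      rw [lift_apply κ p hA, lift_apply κ' p hA]
      exact h _ _ ((by fun_prop : Measurable fun q : State Var × ℝ≥0 => (q.1, p.2 * q.2)) hA)
    · exact le_rfl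
  map_ωSup' c := ext_apply fun σ A hA => by
    rw [ωSup_apply _ _ hA]
    change (cond b hb (seq κ₀ (ωSup c)) _).ker σ A =
      ⨆ n, (cond b hb (seq κ₀ (c n)) (ret (fun σ => (σ, 1)) (by fun_prop))).ker σ A
    simp only [cond_apply]
    split_ifs
    · change (lift (ωSup c) ∘ₖ κ₀.ker) σ A = ⨆ n, (lift (c n) ∘ₖ κ₀.ker) σ A
      have hm : ∀ p : State Var × ℝ≥0,
          MeasurableSet ((fun q : State Var × ℝ≥0 => (q.1, p.2 * q.2)) ⁻¹' A) := fun p =>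
        (by fun_prop : Measurable fun q : State Var × ℝ≥0 => (q.1, p.2 * q.2)) hA
      simp only [Kernel.comp_apply' _ _ _ hA]
      rw [← lintegral_iSup (fun n => Kernel.measurable_coe _ hA)]
      · refine lintegral_congr fun p => ?_
        simp only [lift_apply _ p hA]
        exact ωSup_apply c p.1 (hm p)
      · intro n m h p
        simp only [lift_apply _ p hA]
        exact c.monotone h _ _ (hm p)
    · simp

theorem measurableSet_notMem_dom :
    MeasurableSet {p : String × Rdb | p.1 ∉ Rdb.dom p.2} := by
  have : {p : String × Rdb | p.1 ∉ Rdb.dom p.2} =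
      (fun p : String × Rdb => Rdb.lookup p.2 p.1) ⁻¹' {none} := by
    ext p
    simp [Rdb.lookup, Rdb.dom]
  rw [this]
  refine measurable_lookup ?_
  change MeasurableSet (some ⁻¹' {(none : Option ℝ)})
  simp [Set.preimage]

/-- The measure denoted by a sample statement at the state `σ`, given the name `α`, the mean `m`
and the standard deviation `d`: zero if the name has been used already or `d` is not positive,
and otherwise the law of `((s[x ↦ v], r[α ↦ v]), 1)` for `v` drawn from the normal distribution. -/
noncomputable def sampleMeasure [DecidableEq Var] (x : Var) (σ : State Var) (α : String)
    (m d : ℝ) : Measure (State Var × ℝ≥0) :=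
  if α ∉ Rdb.dom σ.2 ∧ 0 < d then
    (volume.withDensity fun v => (normalDensity v m d : ℝ≥0∞)).map fun v =>
      ((Function.update σ.1 x v, Rdb.insert σ.2 α v), 1)
  else 0

theorem measurable_sample_target [DecidableEq Var] (x : Var) :
    Measurable fun p : (State Var × String) × ℝ =>
      (((Function.update p.1.1.1 x p.2, Rdb.insert p.1.1.2 p.1.2 p.2), 1) : State Var × ℝ≥0) := by
  have h1 : Measurable fun p : (State Var × String) × ℝ => Function.update p.1.1.1 x p.2 :=
    measurable_update'.comp
      (by fun_prop : Measurable fun p : (State Var × String) × ℝ => (p.1.1.1, p.2))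
  have h2 : Measurable fun p : (State Var × String) × ℝ => Rdb.insert p.1.1.2 p.1.2 p.2 :=
    measurable_insert.comp
      (by fun_prop : Measurable fun p : (State Var × String) × ℝ => (p.1.2, (p.2, p.1.1.2)))
  exact (h1.prodMk h2).prodMk measurable_const

theorem sampleMeasure_univ_le [DecidableEq Var] (x : Var) (σ : State Var) (α : String)
    (m d : ℝ) : sampleMeasure x σ α m d Set.univ ≤ 1 := by
  unfold sampleMeasure
  split_ifs with h
  · have hm : Measurable fun v : ℝ =>
        (((Function.update σ.1 x v, Rdb.insert σ.2 α v), 1) : State Var × ℝ≥0) :=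
      (measurable_sample_target x).comp (measurable_prodMk_left (x := (σ, α)))
    rw [Measure.map_apply hm MeasurableSet.univ, Set.preimage_univ,
      withDensity_apply _ MeasurableSet.univ, Measure.restrict_univ]
    have hd : (d ^ 2).toNNReal ≠ 0 := by
      simpa using h.2.ne'
    exact (lintegral_gaussianPDFReal_eq_one m hd).le
  · simp

/-- The kernel of a sample statement. -/
noncomputable def sample [DecidableEq Var] (x : Var) (α : Store Var → String)
    (m d : Store Var → ℝ) (hα : Measurable α) (hm : Measurable m) (hd : Measurable d) :
    SubKernel Var where
  ker :=
    { toFun := fun σ => sampleMeasure x σ (α σ.1) (m σ.1) (d σ.1)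
      measurable' := by
        unfold sampleMeasure
        refine Measurable.ite ?_ ?_ measurable_const
        · exact ((((hα.comp measurable_fst).prodMk measurable_snd) measurableSet_notMem_dom)).inter
            (measurableSet_lt measurable_const (hd.comp measurable_fst))
        · refine Measure.measurable_of_measurable_coe _ fun A hA => ?_
          have ht : Measurable fun p : State Var × ℝ =>
              (((Function.update p.1.1 x p.2, Rdb.insert p.1.2 (α p.1.1) p.2), 1) :
                State Var × ℝ≥0) :=
            (measurable_sample_target x).comp
              (by fun_prop : Measurable fun p : State Var × ℝ => ((p.1, α p.1.1), p.2))
          have hN : Measurable fun p : State Var × ℝ =>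
              (normalDensity p.2 (m p.1.1) (d p.1.1) : ℝ≥0∞) :=
            (measurable_normalDensity_comp measurable_snd (by fun_prop)
              (by fun_prop)).coe_nnreal_ennreal
          have h := ((hN.indicator (ht hA)).lintegral_prod_right'
            (ν := (volume : Measure ℝ)))
          convert h using 2 with σ
          have hs : Measurable fun v : ℝ =>
              (((Function.update σ.1 x v, Rdb.insert σ.2 (α σ.1) v), 1) : State Var × ℝ≥0) :=
            ht.comp (measurable_prodMk_left (x := σ))
          rw [Measure.map_apply hs hA, withDensity_apply _ (hs hA),
            ← lintegral_indicator (hs hA)]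
          rfl }
  le_one σ := sampleMeasure_univ_le x σ _ _ _

/-- The kernel of a score statement, given the observed value `e`, the mean `m` and the standard
deviation `d`. -/
noncomputable def score (e m d : Store Var → ℝ) (he : Measurable e) (hm : Measurable m)
    (hd : Measurable d) : SubKernel Var where
  ker :=
    { toFun := fun σ =>
        if 0 < d σ.1 then Measure.dirac (σ, normalDensity (e σ.1) (m σ.1) (d σ.1)) else 0
      measurable' := by
        refine Measurable.ite (measurableSet_lt measurable_const (hd.comp measurable_fst)) ?_
          measurable_const
        have h : Measurable fun σ : State Var =>
            (σ, normalDensity (e σ.1) (m σ.1) (d σ.1)) :=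
          measurable_id.prodMk (measurable_normalDensity_comp (he.comp measurable_fst)
            (hm.comp measurable_fst) (hd.comp measurable_fst))
        exact Measure.measurable_dirac.comp h }
  le_one σ := by
    change (if 0 < d σ.1 then Measure.dirac (σ, normalDensity (e σ.1) (m σ.1) (d σ.1)) else 0 :
      Measure (State Var × ℝ≥0)) Set.univ ≤ 1
    split_ifs <;> simp

end SubKernel

theorem measurable_assign {Var : Type*} [DecidableEq Var] (x : Var) {e : Store Var → ℝ}
    (he : Measurable e) : Measurable fun s : Store Var => Function.update s x (e s) :=
  measurable_update'.comp (measurable_id.prodMk he)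

section

variable {P : Primitives} {Var : Type*} [DecidableEq Var]

/-- The measure semantics `⟦C⟧` of a command. -/
noncomputable def Cmd.sem : Cmd P Var → SubKernel Var
  | .skip => SubKernel.ret (fun σ => (σ, 1)) (by fun_prop)
  | .assign x E => SubKernel.ret (fun σ => ((Function.update σ.1 x (E.eval σ.1), σ.2), 1))
      ((((measurable_assign x E.measurable_eval).comp measurable_fst).prodMk
        measurable_snd).prodMk measurable_const)
  | .seq C₀ C₁ => SubKernel.seq C₀.sem C₁.sem
  | .ite B C₀ C₁ => SubKernel.cond B.eval B.measurable_eval C₀.sem C₁.sem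
  | .while B C => fix (SubKernel.loop B.eval B.measurable_eval C.sem)
  | .sample x S E₁ E₂ => SubKernel.sample x S.eval E₁.eval E₂.eval S.measurable_eval
      E₁.measurable_eval E₂.measurable_eval
  | .score E₀ E₁ E₂ => SubKernel.score E₀.eval E₁.eval E₂.eval E₀.measurable_eval
      E₁.measurable_eval E₂.measurable_eval

end

/-! ## Density semantics -/

/-- Possible outcomes of the density semantics other than `⊥`: the new store, the part of the
random database that was not consumed, the score, and the probability density. -/
abbrev Outcome (Var : Type*) := Store Var × Rdb × ℝ≥0 × ℝ≥0

/-- `g` uses random databases locally. -/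
def IsLocal {Var : Type*} (g : Store Var × Rdb → Option (Outcome Var)) : Prop :=
  ∀ (s s' : Store Var) (r r' : Rdb) (w' p' : ℝ≥0), g (s, r) = some (s', r', w', p') →
    (∃ r'', Rdb.Disj r' r'' ∧ r = Rdb.union r' r'' ∧
      g (s, r'') = some (s', Rdb.empty, w', p')) ∧
    ∀ t, Rdb.Disj r t →
      g (s, Rdb.union r t) = some (s', Rdb.union r' t, w', p')

/-- The set `𝒟` of measurable and local functions. -/
structure DenFun (Var : Type*) where
  /-- the underlying function -/
  fn : Store Var × Rdb → Option (Outcome Var)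
  measurable_fn : Measurable fn
  local_fn : IsLocal fn

namespace Rdb

theorem ext_lookup {r r' : Rdb} (h : ∀ α, lookup r α = lookup r' α) : r = r' := by
  obtain ⟨K, u⟩ := r
  obtain ⟨K', u'⟩ := r'
  have hK : K = K' := by
    ext α
    have := h α
    by_cases h1 : α ∈ K <;> by_cases h2 : α ∈ K' <;> simp_all [lookup]
  subst hK
  congr 1
  funext α
  have := h α.1
  simpa [lookup] using this

theorem mem_dom_iff (r : Rdb) (α : String) : α ∈ dom r ↔ lookup r α ≠ none := by
  simp [lookup, dom]

theorem disj_iff (r r' : Rdb) :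
    Disj r r' ↔ ∀ α, lookup r α = none ∨ lookup r' α = none := by
  simp only [Disj, Finset.eq_empty_iff_forall_notMem, Finset.mem_inter, mem_dom_iff]
  grind

theorem lookup_empty (α : String) : lookup empty α = none := by
  simp [lookup, empty]

theorem lookup_union (r r' : Rdb) (α : String) :
    lookup (union r r') α = (lookup r α).or (lookup r' α) := by
  by_cases h1 : α ∈ r.1 <;> by_cases h2 : α ∈ r'.1 <;> simp [lookup, union, h1, h2]

theorem lookup_insert (r : Rdb) (α β : String) (v : ℝ) :
    lookup (insert r α v) β = if β = α then some v else lookup r β := by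
  by_cases h1 : β = α <;> by_cases h2 : β ∈ r.1 <;> simp [lookup, insert, h1, h2]

theorem lookup_erase (r : Rdb) (α β : String) :
    lookup (erase r α) β = if β = α then none else lookup r β := by
  by_cases h1 : β = α <;> by_cases h2 : β ∈ r.1 <;> simp [lookup, erase, h1, h2]

end Rdb

namespace DenFun

variable {Var : Type*}

theorem ext_fn {g g' : DenFun Var} (h : ∀ x, g.fn x = g'.fn x) : g = g' := by
  obtain ⟨f, _, _⟩ := g
  obtain ⟨f', _, _⟩ := g'
  have : f = f' := funext h
  subst this
  rfl

/-- The pointwise flat order. -/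
instance : PartialOrder (DenFun Var) where
  le g g' := ∀ x, FlatLE (g.fn x) (g'.fn x)
  le_refl _ _ := Or.inr rfl
  le_trans _ _ _ h h' x := by
    rcases h x with h | h
    · exact Or.inl h
    · have := h' x
      rwa [← h] at this
  le_antisymm _ _ h h' := ext_fn fun x => by
    rcases h x with h | h
    · rcases h' x with h' | h'
      · rw [h, h']
      · exact h'.symm
    · exact h

/-- The least element is the function that is constantly `⊥`. -/
instance : OrderBot (DenFun Var) where
  bot := ⟨fun _ => none, measurable_const, fun _ _ _ _ _ _ h => by simp at h⟩
  bot_le _ _ := Or.inl rfl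

theorem le_iff {g g' : DenFun Var} :
    g ≤ g' ↔ ∀ x t, g.fn x = some t → g'.fn x = some t := by
  refine forall_congr' fun x => ?_
  rcases h : g.fn x with _ | t
  · simp [FlatLE]
  · simp [FlatLE, eq_comm]

/-- The pointwise eventual value of an increasing sequence of functions. -/
noncomputable def supFn (c : Chain (DenFun Var)) (x : Store Var × Rdb) : Option (Outcome Var) :=
  open Classical in if h : ∃ n, (c n).fn x ≠ none then (c h.choose).fn x else none

theorem supFn_eq_some (c : Chain (DenFun Var)) (x : Store Var × Rdb) (t : Outcome Var) :
    supFn c x = some t ↔ ∃ n, (c n).fn x = some t := by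
  have key : ∀ n m a b, (c n).fn x = some a → (c m).fn x = some b → a = b := by
    intro n m a b ha hb
    have h1 := le_iff.1 (c.monotone (le_max_left n m)) x a ha
    have h2 := le_iff.1 (c.monotone (le_max_right n m)) x b hb
    exact Option.some_injective _ (h1.symm.trans h2)
  unfold supFn
  split_ifs with h
  · constructor
    · exact fun h' => ⟨_, h'⟩
    · rintro ⟨n, hn⟩
      obtain ⟨a, ha⟩ := Option.ne_none_iff_exists'.1 h.choose_spec
      rw [ha, key _ _ _ _ ha hn]
  · push Not at h
    simp [h]

/-- Least upper bounds of increasing sequences are taken pointwise. -/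
noncomputable instance : OmegaCompletePartialOrder (DenFun Var) where
  ωSup c :=
    { fn := supFn c
      measurable_fn := by
        refine measurable_option_iff.2 fun A hA => ?_
        have : {x | ∃ y ∈ A, supFn c x = some y} =
            ⋃ n, {x | ∃ y ∈ A, (c n).fn x = some y} := by
          ext x
          simp only [supFn_eq_some, Set.mem_iUnion, Set.mem_ofPred_eq]
          grind
        rw [this]
        exact MeasurableSet.iUnion fun n => measurable_option_iff.1 (c n).measurable_fn A hA
      local_fn := by
        intro s s' r r' w' p' h
        obtain ⟨n, hn⟩ := (supFn_eq_some _ _ _).1 h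
        obtain ⟨⟨r'', h1, h2, h3⟩, h4⟩ := (c n).local_fn s s' r r' w' p' hn
        exact ⟨⟨r'', h1, h2, (supFn_eq_some _ _ _).2 ⟨n, h3⟩⟩,
          fun t hr => (supFn_eq_some _ _ _).2 ⟨n, h4 t hr⟩⟩ }
  le_ωSup c n := le_iff.2 fun x t h => (supFn_eq_some c x t).2 ⟨n, h⟩
  ωSup_le c g h := le_iff.2 fun x t hx => by
    obtain ⟨n, hn⟩ := (supFn_eq_some c x t).1 hx
    exact le_iff.1 (h n) x t hn

theorem ωSup_eq_some (c : Chain (DenFun Var)) (x : Store Var × Rdb) (t : Outcome Var) :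
    (ωSup c).fn x = some t ↔ ∃ n, (c n).fn x = some t :=
  supFn_eq_some c x t

/-- The function that changes the store by `f`, consumes no random choices and returns the score
`1` and the density `1`. -/
def ret (f : Store Var → Store Var) (hf : Measurable f) : DenFun Var where
  fn x := some (f x.1, x.2, 1, 1)
  measurable_fn := measurable_some.comp (by fun_prop)
  local_fn := by
    intro s s' r r' w' p' h
    simp only [Option.some.injEq, Prod.mk.injEq] at h
    obtain ⟨rfl, rfl, rfl, rfl⟩ := h
    refine ⟨⟨Rdb.empty, ?_, ?_, rfl⟩, fun _ _ => rfl⟩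
    · simp [Rdb.disj_iff, Rdb.lookup_empty]
    · exact Rdb.ext_lookup fun α => by simp [Rdb.lookup_union, Rdb.lookup_empty]

/-- The lifting of `g` to `{⊥} ∪ (Store × Rdb × [0,∞) × [0,∞))`, which multiplies the scores and
the densities. -/
def lift (g : DenFun Var) : Option (Outcome Var) → Option (Outcome Var)
  | none => none
  | some (s, r, w, p) =>
    match g.fn (s, r) with
    | none => none
    | some (s', r', w', p') => some (s', r', w * w', p * p')

theorem lift_eq_some (g : DenFun Var) (o : Option (Outcome Var)) (t : Outcome Var) :
    g.lift o = some t ↔ ∃ s r w p s' r' w' p', o = some (s, r, w, p) ∧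
      g.fn (s, r) = some (s', r', w', p') ∧ t = (s', r', w * w', p * p') := by
  rcases o with _ | ⟨s, r, w, p⟩
  · simp [lift]
  · rcases h : g.fn (s, r) with _ | ⟨s', r', w', p'⟩
    · simp only [lift, h, Option.some.injEq, Prod.mk.injEq]
      constructor
      · simp
      · rintro ⟨a, b, c, d, a', b', c', d', ⟨rfl, rfl, rfl, rfl⟩, h', rfl⟩
        simp [h] at h'
    · simp only [lift, h, Option.some.injEq, Prod.mk.injEq]
      constructor
      · rintro rfl
        exact ⟨_, _, _, _, _, _, _, _, ⟨rfl, rfl, rfl, rfl⟩, h, rfl⟩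
      · rintro ⟨a, b, c, d, a', b', c', d', ⟨rfl, rfl, rfl, rfl⟩, h', rfl⟩
        rw [h] at h'
        simp only [Option.some.injEq, Prod.mk.injEq] at h'
        obtain ⟨rfl, rfl, rfl, rfl⟩ := h'
        rfl

instance : Nonempty (Outcome Var) := ⟨(fun _ => 0, Rdb.empty, 0, 0)⟩

theorem measurable_lift (g : DenFun Var) : Measurable g.lift := by
  refine measurable_of_option' ?_
  have h1 : Measurable fun q : Outcome Var × Option (Outcome Var) =>
      match q.2 with
      | none => (none : Option (Outcome Var))
      | some (s', r', w', p') => some (s', r', q.1.2.2.1 * w', q.1.2.2.2 * p') :=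
    measurable_of_option measurable_const (measurable_some.comp (by fun_prop))
  exact h1.comp (measurable_id.prodMk (g.measurable_fn.comp
    (by fun_prop : Measurable fun q : Outcome Var => (q.1, q.2.1))))

/-- Sequential composition. -/
def seq (g₀ g₁ : DenFun Var) : DenFun Var where
  fn := g₁.lift ∘ g₀.fn
  measurable_fn := g₁.measurable_lift.comp g₀.measurable_fn
  local_fn := by
    intro s s' r r' w' p' h
    obtain ⟨s₁, r₁, w₁, p₁, s₂, r₂, w₂, p₂, h0, h1, ht⟩ := (lift_eq_some _ _ _).1 h
    simp only [Prod.mk.injEq] at ht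
    obtain ⟨rfl, rfl, rfl, rfl⟩ := ht
    obtain ⟨⟨a, ha, rfl, ha'⟩, h0'⟩ := g₀.local_fn _ _ _ _ _ _ h0
    obtain ⟨⟨b, hb, rfl, hb'⟩, h1'⟩ := g₁.local_fn _ _ _ _ _ _ h1
    obtain ⟨-, h2⟩ := g₀.local_fn _ _ _ _ _ _ ha'
    simp only [Rdb.disj_iff, Rdb.lookup_union] at ha hb
    refine ⟨⟨Rdb.union a b, ?_, ?_, ?_⟩, ?_⟩
    · simp only [Rdb.disj_iff, Rdb.lookup_union]
      grind
    · refine Rdb.ext_lookup fun α => ?_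
      simp only [Rdb.lookup_union]
      grind
    · refine (lift_eq_some _ _ _).2 ⟨_, _, _, _, _, _, _, _, h2 b ?_, ?_, rfl⟩
      · rw [Rdb.disj_iff]
        grind
      · have : Rdb.union Rdb.empty b = b :=
          Rdb.ext_lookup fun α => by simp [Rdb.lookup_union, Rdb.lookup_empty]
        rw [this]
        exact hb'
    · intro t ht
      refine (lift_eq_some _ _ _).2 ⟨_, _, _, _, _, _, _, _, h0' t ht, h1' t ?_, rfl⟩
      simp only [Rdb.disj_iff, Rdb.lookup_union] at ht ⊢
      grind

/-- Branch on a measurable Boolean function of the store. -/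
def cond (b : Store Var → Bool) (hb : Measurable b) (g₀ g₁ : DenFun Var) : DenFun Var where
  fn x := if b x.1 = true then g₀.fn x else g₁.fn x
  measurable_fn := Measurable.ite (SubKernel.measurableSet_true hb) g₀.measurable_fn
    g₁.measurable_fn
  local_fn := by
    intro s s' r r' w' p' h
    by_cases hs : b s = true
    · simp only [hs, if_true] at h ⊢
      exact g₀.local_fn _ _ _ _ _ _ h
    · simp only [hs] at h ⊢
      exact g₁.local_fn _ _ _ _ _ _ h

/-- The loop functional `g ↦ if B then (g₀; g) else skip`. -/
noncomputable def loop (b : Store Var → Bool) (hb : Measurable b) (g₀ : DenFun Var) :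
    DenFun Var →𝒄 DenFun Var where
  toFun g := cond b hb (seq g₀ g) (ret id measurable_id)
  monotone' g g' h := le_iff.2 fun x t hx => by
    change (if b x.1 = true then g.lift (g₀.fn x) else _) = _ at hx
    change (if b x.1 = true then g'.lift (g₀.fn x) else _) = _
    split_ifs at hx ⊢
    · obtain ⟨s, r, w, p, s', r', w', p', h1, h2, h3⟩ := (lift_eq_some _ _ _).1 hx
      exact (lift_eq_some _ _ _).2 ⟨s, r, w, p, s', r', w', p', h1, le_iff.1 h _ _ h2, h3⟩
    · exact hx
  map_ωSup' c := ext_fn fun x => by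
    refine Option.ext fun t => ?_
    rw [ωSup_eq_some]
    change (if b x.1 = true then (ωSup c).lift (g₀.fn x) else _) = some t ↔
      ∃ n, (if b x.1 = true then (c n).lift (g₀.fn x) else (ret id measurable_id).fn x) = some t
    split_ifs
    · simp only [lift_eq_some, ωSup_eq_some]
      grind
    · simp only [exists_const]

/-- The density semantics of a sample statement, given the name `α`, the mean `m` and the standard
deviation `d`. -/
noncomputable def sample [DecidableEq Var] (x : Var) (α : Store Var → String)
    (m d : Store Var → ℝ) (hα : Measurable α) (hm : Measurable m) (hd : Measurable d) :
    DenFun Var where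
  fn y :=
    match Rdb.lookup y.2 (α y.1) with
    | none => none
    | some v =>
      if 0 < d y.1 then
        some (Function.update y.1 x v, Rdb.erase y.2 (α y.1), 1,
          normalDensity v (m y.1) (d y.1))
      else none
  measurable_fn := by
    have h1 : Measurable fun q : (Store Var × Rdb) × Option ℝ =>
        match q.2 with
        | none => (none : Option (Outcome Var))
        | some v =>
          if 0 < d q.1.1 then
            some (Function.update q.1.1 x v, Rdb.erase q.1.2 (α q.1.1), 1,
              normalDensity v (m q.1.1) (d q.1.1))
          else none := by
      refine measurable_of_option measurable_const ?_
      refine Measurable.ite (measurableSet_lt measurable_const (by fun_prop))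
        (measurable_some.comp ?_) measurable_const
      have h2 : Measurable fun p : (Store Var × Rdb) × ℝ => Function.update p.1.1 x p.2 :=
        measurable_update'.comp
          (by fun_prop : Measurable fun p : (Store Var × Rdb) × ℝ => (p.1.1, p.2))
      have h3 : Measurable fun p : (Store Var × Rdb) × ℝ => Rdb.erase p.1.2 (α p.1.1) :=
        measurable_erase.comp
          (by fun_prop : Measurable fun p : (Store Var × Rdb) × ℝ => (α p.1.1, p.1.2))
      have h4 : Measurable fun p : (Store Var × Rdb) × ℝ =>
          normalDensity p.2 (m p.1.1) (d p.1.1) :=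
        measurable_normalDensity_comp measurable_snd (by fun_prop) (by fun_prop)
      exact h2.prodMk (h3.prodMk (measurable_const.prodMk h4))
    exact h1.comp (measurable_id.prodMk (measurable_lookup.comp
      (by fun_prop : Measurable fun y : Store Var × Rdb => (α y.1, y.2))))
  local_fn := by
    intro s s' r r' w' p' h
    rcases hl : Rdb.lookup r (α s) with _ | v
    · simp [hl] at h
    · simp only [hl] at h
      split_ifs at h with hpos
      simp only [Option.some.injEq, Prod.mk.injEq] at h
      obtain ⟨rfl, rfl, rfl, rfl⟩ := h
      have hone : Rdb.lookup (Rdb.insert Rdb.empty (α s) v) (α s) = some v := by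
        simp [Rdb.lookup_insert]
      refine ⟨⟨Rdb.insert Rdb.empty (α s) v, ?_, ?_, ?_⟩, fun t ht => ?_⟩
      · simp only [Rdb.disj_iff, Rdb.lookup_erase, Rdb.lookup_insert, Rdb.lookup_empty]
        grind
      · refine Rdb.ext_lookup fun β => ?_
        simp only [Rdb.lookup_union, Rdb.lookup_erase, Rdb.lookup_insert, Rdb.lookup_empty]
        grind
      · have : Rdb.erase (Rdb.insert Rdb.empty (α s) v) (α s) = Rdb.empty :=
          Rdb.ext_lookup fun β => by
            simp only [Rdb.lookup_erase, Rdb.lookup_insert, Rdb.lookup_empty]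
            grind
        simp only [hone, if_pos hpos, this]
      · rw [Rdb.disj_iff] at ht
        have h1 : Rdb.lookup (Rdb.union r t) (α s) = some v := by
          simp [Rdb.lookup_union, hl]
        have h2 : Rdb.erase (Rdb.union r t) (α s) = Rdb.union (Rdb.erase r (α s)) t :=
          Rdb.ext_lookup fun β => by
            simp only [Rdb.lookup_erase, Rdb.lookup_union]
            grind
        simp only [h1, if_pos hpos, h2]

/-- The density semantics of a score statement, given the observed value `e`, the mean `m` and the
standard deviation `d`. -/
noncomputable def score (e m d : Store Var → ℝ) (he : Measurable e) (hm : Measurable m)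
    (hd : Measurable d) : DenFun Var where
  fn y := if 0 < d y.1 then some (y.1, y.2, normalDensity (e y.1) (m y.1) (d y.1), 1) else none
  measurable_fn := by
    refine Measurable.ite (measurableSet_lt measurable_const (by fun_prop))
      (measurable_some.comp ?_) measurable_const
    have h : Measurable fun y : Store Var × Rdb => normalDensity (e y.1) (m y.1) (d y.1) :=
      measurable_normalDensity_comp (by fun_prop) (by fun_prop) (by fun_prop)
    exact measurable_fst.prodMk (measurable_snd.prodMk (h.prodMk measurable_const))
  local_fn := by
    intro s s' r r' w' p' h
    beta_reduce at h ⊢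
    split_ifs at h with hpos
    simp only [Option.some.injEq, Prod.mk.injEq] at h
    obtain ⟨rfl, rfl, rfl, rfl⟩ := h
    simp only [if_pos hpos]
    refine ⟨⟨Rdb.empty, ?_, ?_, rfl⟩, fun _ _ => trivial⟩
    · simp [Rdb.disj_iff, Rdb.lookup_empty]
    · exact Rdb.ext_lookup fun α => by simp [Rdb.lookup_union, Rdb.lookup_empty]

/-- `dens(g, s)`. -/
noncomputable def dens (g : DenFun Var) (s : Store Var) (r : Rdb) : ℝ≥0 :=
  open Classical in
  match g.fn (s, r) with
  | none => 0
  | some (_, r', w', p') => if r' = Rdb.empty then w' * p' else 0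

/-- `get(g, s)`. -/
noncomputable def get (g : DenFun Var) (s : Store Var) (r : Rdb) : Option (Store Var) :=
  open Classical in
  match g.fn (s, r) with
  | none => none
  | some (s', r', _, _) => if r' = Rdb.empty then some s' else none

end DenFun

section

variable {P : Primitives} {Var : Type*} [DecidableEq Var]

/-- The density semantics `⟦C⟧_d` of a command. -/
noncomputable def Cmd.den : Cmd P Var → DenFun Var
  | .skip => DenFun.ret id measurable_id
  | .assign x E => DenFun.ret (fun s => Function.update s x (E.eval s))
      (measurable_assign x E.measurable_eval)
  | .seq C₀ C₁ => DenFun.seq C₀.den C₁.den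
  | .ite B C₀ C₁ => DenFun.cond B.eval B.measurable_eval C₀.den C₁.den
  | .while B C => fix (DenFun.loop B.eval B.measurable_eval C.den)
  | .sample x S E₁ E₂ => DenFun.sample x S.eval E₁.eval E₂.eval S.measurable_eval
      E₁.measurable_eval E₂.measurable_eval
  | .score E₀ E₁ E₂ => DenFun.score E₀.eval E₁.eval E₂.eval E₀.measurable_eval
      E₁.measurable_eval E₂.measurable_eval

/-- The unnormalised posterior `Meas(C, A)` of `C` from the initial state `(s, [])`, a number in
`[0, ∞]`. -/
noncomputable def Cmd.unnormPosterior (C : Cmd P Var) (s : Store Var) (A : Set Rdb) : ℝ≥0∞ :=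
  ∫⁻ q : State Var × ℝ≥0, (q.2 : ℝ≥0∞) * (Set.univ ×ˢ A : Set (State Var)).indicator 1 q.1
    ∂C.sem.ker (s, Rdb.empty)

end

end ProbLang

open ProbLang

/-!
Every kernel `⟦C⟧` is *represented* by the density function `⟦C⟧_d` (`Represents`): for each state
`σ` and each measurable `H : State → [0, ∞]`, the score-weighted integral of `H` against `⟦C⟧(σ)` is
the integral over `r`, with respect to `ρ`, of `w' * p' * H (s', r ⊎ σ_r)`, taken over those `r`
disjoint from `σ_r` that `⟦C⟧_d` consumes entirely, that is, `⟦C⟧_d (σ_s, r) = (s', [], w', p')`.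
Both parts of the theorem are instances: where `get` is `⊥`, `dens` vanishes, so only the values of
`h` at proper stores matter.

The proof is by induction on `C` (`represents_sem_den`). Two cases carry the argument.

* Sequencing (`DenFun.lintegral_integrand_seq`). The induction hypotheses give a double integral
  over pairs of disjoint databases `r₁`, `r₂`. Since Lebesgue measure on `K₁ ∪ K₂ → ℝ` is a product
  measure for disjoint `K₁`, `K₂`, that is a single integral over `r`, summed over all ways to split
  `r` (`Rdb.lintegral_lintegral_refMeasure_disj`). By locality at most one split contributes: the one
  in which `r₂` is what the first command leaves of `r` (`DenFun.tsum_integrand_integrand`).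
* Loops (`Represents.fix`). Both fixed points are suprema of iterates from the least element,
  representation is preserved by each iteration, and it passes to suprema of increasing sequences by
  monotone convergence, in the measure on one side (`SubKernel.lintegral_ωSup`) and in the integrand
  on the other (`DenFun.integrand_ωSup`).
-/

namespace ProbLang

/-! ### Random databases -/

namespace Rdb

/-- The restriction of `r` to the names in `K`. -/
def restrict (r : Rdb) (K : Finset String) : Rdb :=
  ⟨r.1 ∩ K, fun β => r.2 ⟨β.1, (Finset.mem_inter.1 β.2).1⟩⟩

theorem lookup_restrict (r : Rdb) (K : Finset String) (α : String) :
    lookup (restrict r K) α = if α ∈ K then lookup r α else none := by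
  by_cases h1 : α ∈ K <;> by_cases h2 : α ∈ r.1 <;> simp [lookup, restrict, h1, h2]

/-- A variant of `mem_dom_iff` for goals in which `dom` has been unfolded. -/
theorem mem_fst_iff (r : Rdb) (α : String) : α ∈ r.1 ↔ lookup r α ≠ none :=
  mem_dom_iff r α

theorem union_empty (r : Rdb) : union r empty = r :=
  ext_lookup fun α => by simp [lookup_union, lookup_empty]

theorem empty_union (r : Rdb) : union empty r = r :=
  ext_lookup fun α => by simp [lookup_union, lookup_empty]

theorem union_comm_of_disj {r r' : Rdb} (h : Disj r r') : union r r' = union r' r := by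
  rw [disj_iff] at h
  refine ext_lookup fun α => ?_
  simp only [lookup_union]
  grind

theorem union_assoc (a b c : Rdb) : union (union a b) c = union a (union b c) :=
  ext_lookup fun α => by simp only [lookup_union]; grind

theorem disj_comm {r r' : Rdb} : Disj r r' ↔ Disj r' r := by
  simp only [Disj, Finset.inter_comm]

theorem empty_disj (r : Rdb) : Disj empty r := by
  simp [disj_iff, lookup_empty]

theorem disj_empty (r : Rdb) : Disj r empty :=
  disj_comm.1 (empty_disj r)

theorem disj_union_left {a b c : Rdb} : Disj (union a b) c ↔ Disj a c ∧ Disj b c := by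
  simp only [disj_iff, lookup_union]
  grind

theorem disj_restrict (r : Rdb) (K : Finset String) :
    Disj (restrict r K) (restrict r (r.1 \ K)) := by
  simp only [disj_iff, lookup_restrict, Finset.mem_sdiff]
  grind

theorem union_restrict (r : Rdb) (K : Finset String) :
    union (restrict r K) (restrict r (r.1 \ K)) = r := by
  refine ext_lookup fun α => ?_
  simp only [lookup_union, lookup_restrict, Finset.mem_sdiff, mem_fst_iff]
  grind

/-- Together with `restrict_union_right`: a disjoint merge is split back into its parts. -/
theorem restrict_union_left {a b : Rdb} (h : Disj a b) : restrict (union a b) a.1 = a := by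
  rw [disj_iff] at h
  refine ext_lookup fun α => ?_
  simp only [lookup_union, lookup_restrict, mem_fst_iff]
  grind

theorem restrict_union_right {a b : Rdb} (h : Disj a b) :
    restrict (union a b) ((union a b).1 \ a.1) = b := by
  rw [disj_iff] at h
  refine ext_lookup fun α => ?_
  simp only [lookup_union, lookup_restrict, mem_fst_iff, Finset.mem_sdiff]
  grind

theorem restrict_fst_of_subset {r : Rdb} {K : Finset String} (h : K ⊆ r.1) :
    (restrict r K).1 = K :=
  Finset.inter_eq_right.2 h

theorem measurable_restrict (K : Finset String) : Measurable fun r : Rdb => restrict r K :=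
  measurable_of_rdb' fun K' => (measurable_sigmaMk (K' ∩ K)).comp
    (measurable_pi_lambda _ fun β =>
      measurable_pi_apply (⟨β.1, (Finset.mem_inter.1 β.2).1⟩ : K'))

theorem measurable_restrict_sdiff (K : Finset String) :
    Measurable fun r : Rdb => restrict r (r.1 \ K) :=
  measurable_of_rdb' fun K' => (measurable_restrict (K' \ K)).comp (measurable_sigmaMk K')

theorem measurable_union : Measurable fun p : Rdb × Rdb => union p.1 p.2 := by
  refine measurable_of_rdb fun K => ?_
  suffices h : Measurable fun q : (K → ℝ) × Rdb => union q.2 ⟨K, q.1⟩ from h.comp measurable_swap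
  refine measurable_of_rdb fun K' => ?_
  refine (measurable_sigmaMk (K' ∪ K)).comp (measurable_pi_lambda _ fun β => ?_)
  by_cases h : β.1 ∈ K'
  · simpa [h, Function.comp_def] using (measurable_pi_apply (⟨β.1, h⟩ : K')).comp measurable_snd
  · have hK : β.1 ∈ K := (Finset.mem_union.1 β.2).resolve_left h
    simpa [h, lookup, hK, Function.comp_def] using
      (measurable_pi_apply (⟨β.1, hK⟩ : K)).comp measurable_fst

theorem measurableSet_fst {p : Finset String → Prop} : MeasurableSet {r : Rdb | p r.1} :=
  MeasurableSpace.measurableSet_iInf.2 fun K' => by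
    change MeasurableSet {_u : K' → ℝ | p K'}
    exact MeasurableSet.const _

theorem measurableSet_disj : MeasurableSet {p : Rdb × Rdb | Disj p.1 p.2} := by
  have : {p : Rdb × Rdb | Disj p.1 p.2} =
      ⋂ α : String, {p | α ∉ p.1.1} ∪ {p | α ∉ p.2.1} := by
    ext p
    simp only [disj_iff, Set.mem_iInter, Set.mem_union, Set.mem_ofPred_eq, mem_fst_iff, not_not]
  rw [this]
  exact MeasurableSet.iInter fun α =>
    (measurable_fst (measurableSet_fst (p := fun K => α ∉ K))).union
      (measurable_snd (measurableSet_fst (p := fun K => α ∉ K)))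

theorem eq_empty_iff (r : Rdb) : r = empty ↔ r.1 = ∅ := by
  constructor
  · rintro rfl
    rfl
  · intro h
    refine ext_lookup fun α => ?_
    rw [lookup_empty]
    simp [lookup, h]

theorem measurableSet_eq_empty : MeasurableSet {r : Rdb | r = empty} := by
  simp only [eq_empty_iff]
  exact measurableSet_fst (p := fun K => K = ∅)

/-! ### Integration against the reference measure -/

theorem lintegral_refMeasure {f : Rdb → ℝ≥0∞} (hf : Measurable f) :
    ∫⁻ r, f r ∂refMeasure = ∑' K : Finset String, ∫⁻ u : K → ℝ, f ⟨K, u⟩ := by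
  rw [refMeasure, lintegral_sum_measure]
  exact tsum_congr fun K => lintegral_map hf (measurable_sigmaMk K)

theorem lintegral_refMeasure_of_fst_eq {f : Rdb → ℝ≥0∞} (hf : Measurable f) (K : Finset String)
    (h : ∀ r : Rdb, r.1 ≠ K → f r = 0) :
    ∫⁻ r, f r ∂refMeasure = ∫⁻ u : K → ℝ, f ⟨K, u⟩ := by
  rw [lintegral_refMeasure hf]
  refine tsum_eq_single K fun K' hK' => ?_
  simp [h ⟨K', _⟩ hK']

theorem lintegral_refMeasure_empty {f : Rdb → ℝ≥0∞} (hf : Measurable f)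
    (h : ∀ r : Rdb, r ≠ empty → f r = 0) : ∫⁻ r, f r ∂refMeasure = f empty := by
  rw [lintegral_refMeasure_of_fst_eq hf ∅ fun r hr => h r (by rwa [Ne, eq_empty_iff])]
  rw [volume_pi, Measure.pi_of_empty _ (fun _ => 0), lintegral_dirac]
  rfl

theorem lintegral_refMeasure_singleton {f : Rdb → ℝ≥0∞} (hf : Measurable f) (α : String)
    (h : ∀ r : Rdb, r.1 ≠ {α} → f r = 0) :
    ∫⁻ r, f r ∂refMeasure = ∫⁻ v : ℝ, f (insert empty α v) := by
  rw [lintegral_refMeasure_of_fst_eq hf {α} h]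
  have hp := volume_preserving_piUnique fun _ : ({α} : Finset String) => ℝ
  rw [(hp.symm _).lintegral_map_equiv]
  refine lintegral_congr fun v => congrArg f (ext_lookup fun β => ?_)
  rw [lookup_insert, lookup_empty]
  by_cases hb : β = α <;> simp [lookup, hb]

/-- Adding a fixed set `K₁` of names is a bijection from the sets disjoint from `K₁` to the
supersets of `K₁`. -/
theorem tsum_disjoint_union (K₁ : Finset String) (f : Finset String → ℝ≥0∞) :
    ∑' K₂ : Finset String, (if Disjoint K₁ K₂ then f (K₁ ∪ K₂) else 0) =
      ∑' K : Finset String, if K₁ ⊆ K then f K else 0 := by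
  let e : {K₂ : Finset String | Disjoint K₁ K₂} ≃ {K : Finset String | K₁ ⊆ K} :=
    { toFun := fun K₂ => ⟨K₁ ∪ K₂.1, Finset.subset_union_left⟩
      invFun := fun K => ⟨K.1 \ K₁, Finset.disjoint_sdiff⟩
      left_inv := fun K₂ => Subtype.ext (Finset.union_sdiff_cancel_left K₂.2)
      right_inv := fun K => Subtype.ext (Finset.union_sdiff_of_subset K.2) }
  have h1 := tsum_subtype {K₂ : Finset String | Disjoint K₁ K₂} fun K₂ => f (K₁ ∪ K₂)
  have h2 := tsum_subtype {K : Finset String | K₁ ⊆ K} f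
  have h3 := e.tsum_eq fun K => f K.1
  simp only [Set.indicator_apply, Set.mem_ofPred_eq] at h1 h2
  rw [← h1, ← h2, ← h3]
  rfl

theorem lintegral_lintegral_pi_of_disjoint {F : Rdb × Rdb → ℝ≥0∞} (hF : Measurable F)
    {K₁ K₂ : Finset String} (h : Disjoint K₁ K₂) :
    ∫⁻ u₁ : K₁ → ℝ, ∫⁻ u₂ : K₂ → ℝ, F (⟨K₁, u₁⟩, ⟨K₂, u₂⟩) =
      ∫⁻ u : (K₁ ∪ K₂ : Finset String) → ℝ,
        F (restrict ⟨K₁ ∪ K₂, u⟩ K₁, restrict ⟨K₁ ∪ K₂, u⟩ ((K₁ ∪ K₂) \ K₁)) := by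
  have hp := volume_preserving_piFinsetUnion (fun _ : String => ℝ) h
  rw [hp.lintegral_map_equiv, Measure.volume_eq_prod, lintegral_prod]
  · refine lintegral_congr fun u₁ => lintegral_congr fun u₂ => congrArg F ?_
    have hd : Disj ⟨K₁, u₁⟩ ⟨K₂, u₂⟩ := Finset.disjoint_iff_inter_eq_empty.1 h
    have hu : (⟨K₁ ∪ K₂, MeasurableEquiv.piFinsetUnion (fun _ : String => ℝ) h (u₁, u₂)⟩ : Rdb) =
        union ⟨K₁, u₁⟩ ⟨K₂, u₂⟩ := by
      refine congrArg (Sigma.mk _) (funext fun β => ?_)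
      change Equiv.piFinsetUnion (fun _ : String => ℝ) h (u₁, u₂) β = _
      by_cases hb : β.1 ∈ K₁
      · simpa [hb] using Equiv.piFinsetUnion_left (fun _ : String => ℝ) h hb β.2
      · have hb' : β.1 ∈ K₂ := (Finset.mem_union.1 β.2).resolve_left hb
        simpa [hb, hb', lookup] using Equiv.piFinsetUnion_right (fun _ : String => ℝ) h hb' β.2
    rw [hu]
    exact Prod.ext (restrict_union_left hd).symm (restrict_union_right hd).symm
  · refine Measurable.aemeasurable ?_
    have hm : Measurable fun r : Rdb => F (restrict r K₁, restrict r (r.1 \ K₁)) :=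
      hF.comp ((measurable_restrict _).prodMk (measurable_restrict_sdiff _))
    exact (hm.comp (measurable_sigmaMk (K₁ ∪ K₂))).comp (MeasurableEquiv.measurable _)

/-- Integrating over disjoint pairs of databases is integrating over their merge, summed over all
ways of splitting it in two. -/
theorem lintegral_lintegral_refMeasure_disj {F : Rdb × Rdb → ℝ≥0∞} (hF : Measurable F)
    (h : ∀ a b, ¬ Disj a b → F (a, b) = 0) :
    ∫⁻ a, ∫⁻ b, F (a, b) ∂refMeasure ∂refMeasure =
      ∫⁻ r : Rdb, ∑' K : Finset String,
        (if K ⊆ r.1 then F (restrict r K, restrict r (r.1 \ K)) else 0) ∂refMeasure := by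
  have hFu : ∀ K₁ K₂ : Finset String, Measurable fun p : (K₁ → ℝ) × (K₂ → ℝ) =>
      F (⟨K₁, p.1⟩, ⟨K₂, p.2⟩) := fun K₁ K₂ =>
    hF.comp (((measurable_sigmaMk K₁).comp measurable_fst).prodMk
      ((measurable_sigmaMk K₂).comp measurable_snd))
  have hinner : ∀ a, ∫⁻ b, F (a, b) ∂refMeasure =
      ∑' K₂ : Finset String, ∫⁻ u₂ : K₂ → ℝ, F (a, ⟨K₂, u₂⟩) := fun a =>
    lintegral_refMeasure (hF.comp measurable_prodMk_left)
  have hm : Measurable fun a : Rdb =>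
      ∑' K₂ : Finset String, ∫⁻ u₂ : K₂ → ℝ, F (a, ⟨K₂, u₂⟩) :=
    Measurable.tsum fun K₂ => measurable_of_rdb' fun K₁ => (hFu K₁ K₂).lintegral_prod_right'
  have hG : ∀ K : Finset String, Measurable fun r : Rdb =>
      if K ⊆ r.1 then F (restrict r K, restrict r (r.1 \ K)) else 0 := fun K =>
    Measurable.ite (measurableSet_fst (p := fun K' => K ⊆ K'))
      (hF.comp ((measurable_restrict _).prodMk (measurable_restrict_sdiff _))) measurable_const
  simp only [hinner]
  rw [lintegral_refMeasure hm, lintegral_tsum fun K => (hG K).aemeasurable]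
  refine tsum_congr fun K₁ => ?_
  rw [lintegral_tsum fun K₂ => (hFu K₁ K₂).lintegral_prod_right'.aemeasurable,
    lintegral_refMeasure (hG K₁)]
  trans ∑' K : Finset String, if K₁ ⊆ K then
    ∫⁻ u : K → ℝ, F (restrict ⟨K, u⟩ K₁, restrict ⟨K, u⟩ (K \ K₁)) else 0
  · rw [← tsum_disjoint_union]
    refine tsum_congr fun K₂ => ?_
    split_ifs with hd
    · exact lintegral_lintegral_pi_of_disjoint hF hd
    · have h0 : ∀ (u₁ : K₁ → ℝ) (u₂ : K₂ → ℝ), F (⟨K₁, u₁⟩, ⟨K₂, u₂⟩) = 0 := fun u₁ u₂ =>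
        h _ _ fun h' => hd (Finset.disjoint_iff_inter_eq_empty.2 h')
      simp [h0]
  · refine tsum_congr fun K => ?_
    split_ifs <;> simp

end Rdb

/-! ### The density integrand -/

namespace DenFun

variable {Var : Type*}

/-- The contribution of the database `r` to the integral of `H` that the density semantics assigns
to a run from `σ`: it is `w' * p' * H (s', r ⊎ σ_r)` if `g` consumes all of `r` and returns
`(s', [], w', p')`, and `r` is disjoint from `σ_r`; in all other cases it is `0`. -/
noncomputable def integrand (g : DenFun Var) (H : State Var → ℝ≥0∞) (σ : State Var) (r : Rdb) :
    ℝ≥0∞ :=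
  open Classical in
  match g.fn (σ.1, r) with
  | none => 0
  | some (s', r', w', p') =>
    if r' = Rdb.empty ∧ Rdb.Disj r σ.2 then w' * p' * H (s', Rdb.union r σ.2) else 0

variable {g : DenFun Var} {H : State Var → ℝ≥0∞} {σ : State Var} {r : Rdb}

theorem integrand_of_eq_some {s' : Store Var} {w' p' : ℝ≥0}
    (h : g.fn (σ.1, r) = some (s', Rdb.empty, w', p')) (hd : Rdb.Disj r σ.2) :
    g.integrand H σ r = w' * p' * H (s', Rdb.union r σ.2) := by
  simp [integrand, h, hd]

theorem integrand_of_not_disj (hd : ¬ Rdb.Disj r σ.2) : g.integrand H σ r = 0 := by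
  unfold integrand
  split <;> simp [hd]

theorem integrand_of_forall_ne
    (h : ∀ s' w' p', g.fn (σ.1, r) ≠ some (s', Rdb.empty, w', p')) :
    g.integrand H σ r = 0 := by
  unfold integrand
  split
  · rfl
  · rename_i s' r' w' p' heq
    rw [if_neg]
    rintro ⟨rfl, -⟩
    exact h _ _ _ heq

theorem integrand_of_forall_eq_zero (h : ∀ s', H (s', Rdb.union r σ.2) = 0) :
    g.integrand H σ r = 0 := by
  unfold integrand
  split <;> simp [h]

theorem measurable_integrand_comp {X : Type*} [MeasurableSpace X] (g : DenFun Var)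
    {H : X → State Var → ℝ≥0∞} (hH : Measurable fun p : X × State Var => H p.1 p.2)
    {σ : X → State Var} (hσ : Measurable σ)
    {r : X → Rdb} (hr : Measurable r) : Measurable fun x => g.integrand (H x) (σ x) (r x) := by
  classical
  have h1 : Measurable fun q : X × Option (Outcome Var) =>
      match q.2 with
      | none => (0 : ℝ≥0∞)
      | some (s', r', w', p') =>
        if r' = Rdb.empty ∧ Rdb.Disj (r q.1) (σ q.1).2 then
          w' * p' * H q.1 (s', Rdb.union (r q.1) (σ q.1).2) else 0 := by
    refine measurable_of_option measurable_const ?_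
    refine Measurable.ite (.inter ?_ ?_) (.mul ?_ ?_) measurable_const
    · exact (measurable_fst.comp (measurable_snd.comp measurable_snd))
        Rdb.measurableSet_eq_empty
    · exact (by fun_prop : Measurable fun q : X × Outcome Var => (r q.1, (σ q.1).2))
        Rdb.measurableSet_disj
    · fun_prop
    · have hu : Measurable fun q : X × Outcome Var => Rdb.union (r q.1) (σ q.1).2 :=
        Rdb.measurable_union.comp
          (by fun_prop : Measurable fun q : X × Outcome Var => (r q.1, (σ q.1).2))
      exact hH.comp (measurable_fst.prodMk ((measurable_fst.comp measurable_snd).prodMk hu))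
  have h2 : Measurable fun x => g.fn ((σ x).1, r x) :=
    g.measurable_fn.comp (by fun_prop)
  exact h1.comp (measurable_id.prodMk h2)

theorem measurable_integrand (g : DenFun Var) (hH : Measurable H) (σ : State Var) :
    Measurable (g.integrand H σ) :=
  measurable_integrand_comp (X := Rdb) (H := fun _ => H) g (hH.comp measurable_snd) measurable_const
    measurable_id

/-- Integration over a parameter of `H` commutes with forming the integrand. -/
theorem lintegral_integrand {Y : Type*} [MeasurableSpace Y] {μ : Measure Y} (g : DenFun Var)
    {H : Y → State Var → ℝ≥0∞} (hH : ∀ σ, Measurable fun y => H y σ) (σ : State Var) (r : Rdb) :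
    g.integrand (fun σ' => ∫⁻ y, H y σ' ∂μ) σ r = ∫⁻ y, g.integrand (H y) σ r ∂μ := by
  unfold integrand
  split
  · simp
  · split_ifs
    · rw [lintegral_const_mul _ (hH _)]
    · simp

theorem integrand_mono {g' : DenFun Var} (h : g ≤ g') :
    g.integrand H σ r ≤ g'.integrand H σ r := by
  rcases hg : g.fn (σ.1, r) with _ | t
  · simp [integrand, hg]
  · have := le_iff.1 h _ _ hg
    simp [integrand, hg, this]

theorem integrand_ωSup (c : Chain (DenFun Var)) (H : State Var → ℝ≥0∞) (σ : State Var)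
    (r : Rdb) : (ωSup c).integrand H σ r = ⨆ n, (c n).integrand H σ r := by
  refine le_antisymm ?_ (iSup_le fun n => integrand_mono (le_ωSup c n))
  rcases hg : (ωSup c).fn (σ.1, r) with _ | t
  · simp [integrand, hg]
  · obtain ⟨n, hn⟩ := (ωSup_eq_some _ _ _).1 hg
    refine le_trans (le_of_eq ?_) (le_iSup _ n)
    simp [integrand, hg, hn]

/-- A run of `C₀; C₁` that consumes `r` splits `r` in exactly one way into the part consumed by `C₀`
and the part consumed by `C₁`: by locality `g₀` returns, on `r`, precisely the part it leaves. -/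
theorem tsum_integrand_integrand (g₀ g₁ : DenFun Var) (H : State Var → ℝ≥0∞) (σ : State Var)
    (r : Rdb) :
    ∑' K : Finset String, (if K ⊆ r.1 then
      g₀.integrand (fun σ' => g₁.integrand H σ' (Rdb.restrict r (r.1 \ K))) σ
        (Rdb.restrict r K) else 0) = (seq g₀ g₁).integrand H σ r := by
  have hloc : ∀ K s' w' p', g₀.fn (σ.1, Rdb.restrict r K) = some (s', Rdb.empty, w', p') →
      g₀.fn (σ.1, r) = some (s', Rdb.restrict r (r.1 \ K), w', p') := by
    intro K s' w' p' h
    have := (g₀.local_fn _ _ _ _ _ _ h).2 _ (Rdb.disj_restrict r K)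
    rwa [Rdb.union_restrict, Rdb.empty_union] at this
  have hseq : (seq g₀ g₁).fn (σ.1, r) = g₁.lift (g₀.fn (σ.1, r)) := rfl
  rcases hg : g₀.fn (σ.1, r) with _ | ⟨s₁, r₂, w₁, p₁⟩
  · have hR : (seq g₀ g₁).integrand H σ r = 0 := by simp [integrand, hseq, hg, lift]
    rw [hR]
    refine ENNReal.tsum_eq_zero.2 fun K => ?_
    split_ifs
    · refine integrand_of_forall_ne fun s' w' p' h => ?_
      have := hloc _ _ _ _ h
      simp [hg] at this
    · rfl
  · obtain ⟨⟨r₁, hd, hr, h₁⟩, -⟩ := g₀.local_fn _ _ _ _ _ _ hg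
    rw [Rdb.union_comm_of_disj hd] at hr
    rw [Rdb.disj_comm] at hd
    have hr₁ : Rdb.restrict r r₁.1 = r₁ := by rw [hr, Rdb.restrict_union_left hd]
    have hr₂ : Rdb.restrict r (r.1 \ r₁.1) = r₂ := by rw [hr, Rdb.restrict_union_right hd]
    have hsub : r₁.1 ⊆ r.1 := by
      rw [hr]
      exact Finset.subset_union_left
    rw [tsum_eq_single r₁.1, if_pos hsub, hr₁, hr₂]
    · by_cases hdσ : Rdb.Disj r σ.2
      · obtain ⟨hd₁, hd₂⟩ := Rdb.disj_union_left.1 (hr ▸ hdσ)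
        have hd₂' : Rdb.Disj r₂ (Rdb.union r₁ σ.2) := by
          rw [Rdb.disj_comm, Rdb.disj_union_left]
          exact ⟨hd, Rdb.disj_comm.1 hd₂⟩
        have hU : Rdb.union r₂ (Rdb.union r₁ σ.2) = Rdb.union r σ.2 := by
          rw [← Rdb.union_assoc, ← Rdb.union_comm_of_disj hd, ← hr]
        rw [integrand_of_eq_some h₁ hd₁]
        rcases hg₁ : g₁.fn (s₁, r₂) with _ | ⟨s₂, r₃, w₂, p₂⟩
        · simp [integrand, hseq, hg, hg₁, lift]
        · by_cases hr₃ : r₃ = Rdb.empty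
          · simp only [integrand, hseq, hg, hg₁, lift, hd₂', hr₃, hdσ, hU, and_self, if_true,
              ENNReal.coe_mul]
            ring
          · simp [integrand, hseq, hg, hg₁, lift, hr₃]
      · rw [integrand_of_not_disj hdσ]
        by_cases hd₁ : Rdb.Disj r₁ σ.2
        · rw [integrand_of_eq_some h₁ hd₁, integrand_of_not_disj, mul_zero]
          intro hd₂
          rw [Rdb.disj_comm, Rdb.disj_union_left] at hd₂
          exact hdσ (hr ▸ Rdb.disj_union_left.2 ⟨hd₁, Rdb.disj_comm.1 hd₂.2⟩)
        · exact integrand_of_not_disj hd₁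
    · intro K hK
      split_ifs with hKr
      · refine integrand_of_forall_ne fun s' w' p' h => hK ?_
        have h' := hloc _ _ _ _ h
        rw [hg] at h'
        simp only [Option.some.injEq, Prod.mk.injEq] at h'
        have hfst := congrArg Sigma.fst (hr₂.trans h'.2.1)
        rw [Rdb.restrict_fst_of_subset Finset.sdiff_subset,
          Rdb.restrict_fst_of_subset Finset.sdiff_subset] at hfst
        rw [← Finset.sdiff_sdiff_eq_self hKr, ← hfst, Finset.sdiff_sdiff_eq_self hsub]
      · rfl

theorem lintegral_integrand_seq (g₀ g₁ : DenFun Var) (hH : Measurable H) (σ : State Var) :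
    ∫⁻ r, (seq g₀ g₁).integrand H σ r ∂(Rdb.refMeasure) =
      ∫⁻ r₁, g₀.integrand (fun σ' => ∫⁻ r₂, g₁.integrand H σ' r₂ ∂(Rdb.refMeasure)) σ r₁
        ∂(Rdb.refMeasure) := by
  have hF : Measurable fun p : Rdb × Rdb =>
      g₀.integrand (fun σ' => g₁.integrand H σ' p.2) σ p.1 := by
    refine measurable_integrand_comp (X := Rdb × Rdb)
      (H := fun p σ' => g₁.integrand H σ' p.2) g₀ ?_ measurable_const measurable_fst
    exact measurable_integrand_comp (X := (Rdb × Rdb) × State Var) (H := fun _ => H) g₁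
      (hH.comp measurable_snd) measurable_snd (by fun_prop)
  have hsplit := Rdb.lintegral_lintegral_refMeasure_disj hF fun a b hab => by
    refine integrand_of_forall_eq_zero fun s' => integrand_of_not_disj fun h => ?_
    exact hab (Rdb.disj_union_left.1 (Rdb.disj_comm.1 h)).1
  simp only [tsum_integrand_integrand] at hsplit
  rw [← hsplit]
  refine lintegral_congr fun a => (lintegral_integrand g₀ (fun σ' => ?_) σ a).symm
  exact measurable_integrand g₁ hH σ'

end DenFun

/-! ### Integration against subprobability kernels -/

namespace SubKernel

variable {Var : Type*}

/-- Monotone convergence in the measure: the integral against a supremum of an increasing sequence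
of kernels is the supremum of the integrals. -/
theorem lintegral_ωSup (c : Chain (SubKernel Var)) (σ : State Var)
    {f : State Var × ℝ≥0 → ℝ≥0∞} (hf : Measurable f) :
    ∫⁻ q, f q ∂(ωSup c).ker σ = ⨆ n, ∫⁻ q, f q ∂(c n).ker σ := by
  have hle : ∀ n m, n ≤ m → (c n).ker σ ≤ (c m).ker σ := fun n m h =>
    Measure.le_iff.2 fun A hA => c.monotone h σ A hA
  refine Measurable.ennreal_induction (motive := fun f =>
    ∫⁻ q, f q ∂(ωSup c).ker σ = ⨆ n, ∫⁻ q, f q ∂(c n).ker σ) ?_ ?_ ?_ hf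
  · intro a A hA
    simp only [lintegral_indicator_const hA, ωSup_apply c σ hA, ENNReal.mul_iSup]
  · intro f g _ hf hg ihf ihg
    simp only [Pi.add_apply, lintegral_add_left hf, ihf, ihg]
    exact ENNReal.iSup_add_iSup_of_monotone (fun n m h => lintegral_mono' (hle n m h) le_rfl)
      fun n m h => lintegral_mono' (hle n m h) le_rfl
  · intro f hf hmono ih
    simp only [lintegral_iSup hf hmono, ih]
    exact iSup_comm

theorem lintegral_seq (κ₀ κ₁ : SubKernel Var) (σ : State Var) {H : State Var → ℝ≥0∞}
    (hH : Measurable H) :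
    ∫⁻ q, q.2 * H q.1 ∂(seq κ₀ κ₁).ker σ =
      ∫⁻ p, p.2 * ∫⁻ q, q.2 * H q.1 ∂κ₁.ker p.1 ∂κ₀.ker σ := by
  have hm : Measurable fun q : State Var × ℝ≥0 => (q.2 : ℝ≥0∞) * H q.1 := by fun_prop
  change ∫⁻ q, q.2 * H q.1 ∂(lift κ₁ ∘ₖ κ₀.ker) σ = _
  rw [Kernel.lintegral_comp _ _ _ hm]
  refine lintegral_congr fun p => ?_
  change ∫⁻ q, q.2 * H q.1 ∂(κ₁.ker p.1).map (fun q => (q.1, p.2 * q.2)) = _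
  rw [lintegral_map hm (by fun_prop), ← lintegral_const_mul _ hm]
  exact lintegral_congr fun q => by simp only [ENNReal.coe_mul, mul_assoc]

end SubKernel

/-! ### Kernels represented by densities -/

variable {Var : Type*}

/-- The kernel `κ` is represented by the density function `g`: score-weighted integrals against `κ`
are integrals of `g` over the databases consumed by the run, with respect to `ρ`. -/
def Represents (κ : SubKernel Var) (g : DenFun Var) : Prop :=
  ∀ (σ : State Var) (H : State Var → ℝ≥0∞), Measurable H →
    ∫⁻ q, q.2 * H q.1 ∂κ.ker σ = ∫⁻ r, g.integrand H σ r ∂(Rdb.refMeasure)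

namespace Represents

theorem bot : Represents (⊥ : SubKernel Var) ⊥ := by
  intro σ H _
  have h : ∀ r, (⊥ : DenFun Var).integrand H σ r = 0 := fun _ => rfl
  change ∫⁻ q, q.2 * H q.1 ∂(0 : Kernel (State Var) (State Var × ℝ≥0)) σ = _
  simp [h]

/-- If `g` never consumes a random choice, only the empty database contributes to its integral. -/
theorem lintegral_of_consumes_none {g : DenFun Var} {H : State Var → ℝ≥0∞} (hH : Measurable H)
    {σ : State Var} (h : ∀ (r : Rdb) s' r' w' p', g.fn (σ.1, r) = some (s', r', w', p') → r' = r) :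
    ∫⁻ r, g.integrand H σ r ∂(Rdb.refMeasure) = g.integrand H σ Rdb.empty :=
  Rdb.lintegral_refMeasure_empty (DenFun.measurable_integrand g hH σ) fun _ hr =>
    DenFun.integrand_of_forall_ne fun _ _ _ h' => hr (h _ _ _ _ _ h').symm

theorem ret (f : Store Var → Store Var) (hf : Measurable f)
    (hf' : Measurable fun σ : State Var => (((f σ.1, σ.2), 1) : State Var × ℝ≥0)) :
    Represents (SubKernel.ret (fun σ => ((f σ.1, σ.2), 1)) hf') (DenFun.ret f hf) := by
  intro σ H hH
  rw [lintegral_of_consumes_none hH, DenFun.integrand_of_eq_some (s' := f σ.1) (w' := 1) (p' := 1)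
    rfl (Rdb.empty_disj _)]
  · change ∫⁻ q, q.2 * H q.1 ∂Kernel.deterministic _ hf' σ = _
    rw [Kernel.lintegral_deterministic' hf' (by fun_prop), Rdb.empty_union]
    simp
  · intro r s' r' w' p' h
    simp only [DenFun.ret, Option.some.injEq, Prod.mk.injEq] at h
    exact h.2.1.symm

theorem seq {κ₀ κ₁ : SubKernel Var} {g₀ g₁ : DenFun Var} (h₀ : Represents κ₀ g₀)
    (h₁ : Represents κ₁ g₁) : Represents (SubKernel.seq κ₀ κ₁) (DenFun.seq g₀ g₁) := by
  intro σ H hH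
  have hm : Measurable fun σ' : State Var => ∫⁻ q, q.2 * H q.1 ∂κ₁.ker σ' :=
    Measurable.lintegral_kernel (by fun_prop)
  rw [SubKernel.lintegral_seq κ₀ κ₁ σ hH, h₀ σ _ hm, DenFun.lintegral_integrand_seq g₀ g₁ hH]
  simp only [h₁ _ H hH]

theorem cond (b : Store Var → Bool) (hb : Measurable b) {κ₀ κ₁ : SubKernel Var}
    {g₀ g₁ : DenFun Var} (h₀ : Represents κ₀ g₀) (h₁ : Represents κ₁ g₁) :
    Represents (SubKernel.cond b hb κ₀ κ₁) (DenFun.cond b hb g₀ g₁) := by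
  intro σ H hH
  rw [SubKernel.cond_apply]
  by_cases hs : b σ.1 = true
  · rw [if_pos hs, h₀ σ H hH]
    simp [DenFun.integrand, DenFun.cond, hs]
  · rw [if_neg hs, h₁ σ H hH]
    simp [DenFun.integrand, DenFun.cond, hs]

theorem ωSup {c : Chain (SubKernel Var)} {d : Chain (DenFun Var)}
    (h : ∀ n, Represents (c n) (d n)) : Represents (ωSup c) (ωSup d) := by
  intro σ H hH
  rw [SubKernel.lintegral_ωSup c σ (by fun_prop)]
  simp only [DenFun.integrand_ωSup]
  rw [lintegral_iSup fun n => DenFun.measurable_integrand (d n) hH σ]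
  · exact iSup_congr fun n => h n σ H hH
  · exact fun n m hnm r => DenFun.integrand_mono (d.monotone hnm)

theorem fix {F : SubKernel Var →𝒄 SubKernel Var} {G : DenFun Var →𝒄 DenFun Var}
    (h : ∀ κ g, Represents κ g → Represents (F κ) (G g)) : Represents (fix F) (fix G) := by
  refine ωSup fun n => ?_
  change Represents (F^[n] ⊥) (G^[n] ⊥)
  induction n with
  | zero => exact bot
  | succ n ih =>
    rw [Function.iterate_succ_apply', Function.iterate_succ_apply']
    exact h _ _ ih

theorem loop (b : Store Var → Bool) (hb : Measurable b) {κ₀ : SubKernel Var} {g₀ : DenFun Var}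
    (h₀ : Represents κ₀ g₀) : Represents (ProbLang.fix (SubKernel.loop b hb κ₀))
      (ProbLang.fix (DenFun.loop b hb g₀)) :=
  fix fun _ _ h => cond b hb (h₀.seq h) (ret id measurable_id (by fun_prop))

theorem score (e m d : Store Var → ℝ) (he : Measurable e) (hm : Measurable m)
    (hd : Measurable d) :
    Represents (SubKernel.score e m d he hm hd) (DenFun.score e m d he hm hd) := by
  intro σ H hH
  change ∫⁻ q, q.2 * H q.1 ∂(if 0 < d σ.1 then
    Measure.dirac (σ, normalDensity (e σ.1) (m σ.1) (d σ.1)) else 0 : Measure _) = _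
  by_cases hpos : 0 < d σ.1
  · rw [lintegral_of_consumes_none hH, DenFun.integrand_of_eq_some (s' := σ.1)
      (w' := normalDensity (e σ.1) (m σ.1) (d σ.1)) (p' := 1) (if_pos hpos) (Rdb.empty_disj _),
      if_pos hpos, lintegral_dirac' _ (by fun_prop), Rdb.empty_union]
    · simp
    · intro r s' r' w' p' h
      simp only [DenFun.score, hpos, if_true, Option.some.injEq, Prod.mk.injEq] at h
      exact h.2.1.symm
  · simp [DenFun.integrand, DenFun.score, hpos]

theorem sample [DecidableEq Var] (x : Var) (α : Store Var → String) (m d : Store Var → ℝ)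
    (hα : Measurable α) (hm : Measurable m) (hd : Measurable d) :
    Represents (SubKernel.sample x α m d hα hm hd) (DenFun.sample x α m d hα hm hd) := by
  intro σ H hH
  change ∫⁻ q, q.2 * H q.1 ∂SubKernel.sampleMeasure x σ (α σ.1) (m σ.1) (d σ.1) = _
  -- A database is consumed completely only if its domain consists of the sampled name.
  have hfst : ∀ (r : Rdb) s' w' p', (DenFun.sample x α m d hα hm hd).fn (σ.1, r) =
      some (s', Rdb.empty, w', p') → 0 < d σ.1 ∧ r.1 = {α σ.1} := by
    intro r s' w' p' h
    rcases hl : Rdb.lookup r (α σ.1) with _ | v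
    · simp [DenFun.sample, hl] at h
    · simp only [DenFun.sample, hl] at h
      split_ifs at h with hpos
      simp only [Option.some.injEq, Prod.mk.injEq] at h
      refine ⟨hpos, ?_⟩
      have he : r.1.erase (α σ.1) = ∅ := (Rdb.eq_empty_iff _).1 h.2.1
      have hmem : α σ.1 ∈ r.1 := by simp [Rdb.mem_fst_iff, hl]
      rw [← Finset.insert_erase hmem, he]
      rfl
  rw [Rdb.lintegral_refMeasure_singleton (DenFun.measurable_integrand _ hH σ) (α σ.1) fun r hr =>
    DenFun.integrand_of_forall_ne fun _ _ _ h => hr (hfst _ _ _ _ h).2]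
  have hdisj : ∀ v, Rdb.Disj (Rdb.insert Rdb.empty (α σ.1) v) σ.2 ↔ α σ.1 ∉ Rdb.dom σ.2 := by
    intro v
    simp only [Rdb.disj_iff, Rdb.lookup_insert, Rdb.lookup_empty, Rdb.mem_dom_iff]
    grind
  unfold SubKernel.sampleMeasure
  split_ifs with hc
  · obtain ⟨hdom, hpos⟩ := hc
    have hN : Measurable fun v : ℝ => (normalDensity v (m σ.1) (d σ.1) : ℝ≥0∞) :=
      (measurable_normalDensity_comp measurable_id measurable_const
        measurable_const).coe_nnreal_ennreal
    have ht : Measurable fun v : ℝ => (((Function.update σ.1 x v, Rdb.insert σ.2 (α σ.1) v), 1) :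
        State Var × ℝ≥0) :=
      (SubKernel.measurable_sample_target x).comp (measurable_prodMk_left (x := (σ, α σ.1)))
    have hwH : Measurable fun q : State Var × ℝ≥0 => (q.2 : ℝ≥0∞) * H q.1 := by fun_prop
    rw [lintegral_map hwH ht]
    refine (lintegral_withDensity_eq_lintegral_mul _ hN (hwH.comp ht)).trans
      (lintegral_congr fun v => ?_)
    have hfn : (DenFun.sample x α m d hα hm hd).fn (σ.1, Rdb.insert Rdb.empty (α σ.1) v) =
        some (Function.update σ.1 x v, Rdb.empty, 1, normalDensity v (m σ.1) (d σ.1)) := by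
      have hone : Rdb.lookup (Rdb.insert Rdb.empty (α σ.1) v) (α σ.1) = some v := by
        simp [Rdb.lookup_insert]
      have he : Rdb.erase (Rdb.insert Rdb.empty (α σ.1) v) (α σ.1) = Rdb.empty :=
        Rdb.ext_lookup fun β => by
          simp only [Rdb.lookup_erase, Rdb.lookup_insert, Rdb.lookup_empty]
          grind
      simp only [DenFun.sample, hone, if_pos hpos, he]
    have hU : Rdb.union (Rdb.insert Rdb.empty (α σ.1) v) σ.2 = Rdb.insert σ.2 (α σ.1) v :=
      Rdb.ext_lookup fun β => by
        simp only [Rdb.lookup_union, Rdb.lookup_insert, Rdb.lookup_empty]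
        grind
    rw [DenFun.integrand_of_eq_some hfn ((hdisj v).2 hdom), hU]
    simp
  · have h0 : ∀ v, (DenFun.sample x α m d hα hm hd).integrand H σ
        (Rdb.insert Rdb.empty (α σ.1) v) = 0 := by
      intro v
      by_cases hdom : α σ.1 ∉ Rdb.dom σ.2
      · exact DenFun.integrand_of_forall_ne fun _ _ _ h => hc ⟨hdom, (hfst _ _ _ _ h).1⟩
      · exact DenFun.integrand_of_not_disj (mt (hdisj v).1 hdom)
    simp [h0]

end Represents

theorem represents_sem_den {P : Primitives} [DecidableEq Var] (C : Cmd P Var) :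
    Represents C.sem C.den := by
  induction C with
  | skip => exact .ret id measurable_id _
  | assign x E => exact .ret _ (measurable_assign x E.measurable_eval) _
  | seq C₀ C₁ h₀ h₁ => exact h₀.seq h₁
  | ite B C₀ C₁ h₀ h₁ => exact h₀.cond _ _ h₁
  | sample x S E₁ E₂ => exact Represents.sample x _ _ _ _ _ _
  | score E₀ E₁ E₂ => exact Represents.score _ _ _ _ _ _
  -- The remaining constructor is the loop, whose name is a keyword.
  | _ B C h => exact h.loop _ _

/-! ### The density and the final store -/

namespace DenFun

/-- The integrand in terms of `dens` and `get`. The value of `h` at `⊥` is irrelevant, because `dens`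
vanishes where `get` is `⊥`. -/
theorem dens_mul_indicator_mul (g : DenFun Var) (h : Option (Store Var) × Rdb → ℝ≥0∞)
    (σ : State Var) (r : Rdb) :
    (g.dens σ.1 r : ℝ≥0∞) * {r | Rdb.Disj r σ.2}.indicator 1 r *
        h (g.get σ.1 r, Rdb.union r σ.2) =
      g.integrand (fun σ' => h (some σ'.1, σ'.2)) σ r := by
  classical
  rcases hg : g.fn (σ.1, r) with _ | ⟨s', r', w', p'⟩
  · simp [dens, integrand, hg]
  · by_cases hr : r' = Rdb.empty <;> by_cases hd : Rdb.Disj r σ.2 <;>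
      simp [dens, get, integrand, hg, hr, hd]

theorem coe_dens (g : DenFun Var) (s : Store Var) (r : Rdb) :
    (g.dens s r : ℝ≥0∞) = g.integrand 1 (s, Rdb.empty) r := by
  have hd : Rdb.Disj r Rdb.empty := Rdb.disj_empty r
  have := g.dens_mul_indicator_mul 1 (s, Rdb.empty) r
  simpa [hd, Pi.one_def] using this

theorem measurable_dens (g : DenFun Var) (s : Store Var) : Measurable (g.dens s) := by
  rw [← measurable_coe_nnreal_ennreal_iff]
  simp only [coe_dens]
  exact measurable_integrand g measurable_one _

end DenFun

end ProbLang

theorem mainTheorem5 {Var : Type*} [DecidableEq Var] [Countable Var] [Infinite Var]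
    (P : Primitives) (C : Cmd P Var) :
    (∀ (σ : State Var) (h : Option (Store Var) × Rdb → ℝ),
      (∀ x, 0 ≤ h x) → (∃ M, ∀ x, h x ≤ M) → Measurable h →
      (∀ a b r, FlatLE a b → h (a, r) ≤ h (b, r)) →
      Measurable (fun r' : Rdb =>
        (C.den.dens σ.1 r' : ℝ≥0∞) * {r | Rdb.Disj r σ.2}.indicator 1 r' *
          ENNReal.ofReal (h (C.den.get σ.1 r', Rdb.union r' σ.2))) ∧
      (∫⁻ q : State Var × ℝ≥0,
          (q.2 : ℝ≥0∞) * ENNReal.ofReal (h (some q.1.1, q.1.2)) ∂(C.sem.ker σ)) =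
        ∫⁻ r' : Rdb, (C.den.dens σ.1 r' : ℝ≥0∞) * {r | Rdb.Disj r σ.2}.indicator 1 r' *
          ENNReal.ofReal (h (C.den.get σ.1 r', Rdb.union r' σ.2)) ∂(Rdb.refMeasure)) ∧
    (∀ s : Store Var, Measurable (C.den.dens s) ∧
      ∀ A : Set Rdb, MeasurableSet A →
        C.unnormPosterior s A =
          ∫⁻ r : Rdb, A.indicator 1 r * (C.den.dens s r : ℝ≥0∞) ∂(Rdb.refMeasure)) := by
  refine ⟨fun σ h _ _ hm _ => ?_, fun s => ⟨C.den.measurable_dens s, fun A hA => ?_⟩⟩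
  · have hH : Measurable fun σ' : State Var => ENNReal.ofReal (h (some σ'.1, σ'.2)) :=
      (hm.comp ((measurable_some.comp measurable_fst).prodMk measurable_snd)).ennreal_ofReal
    simp only [C.den.dens_mul_indicator_mul fun x => ENNReal.ofReal (h x)]
    exact ⟨C.den.measurable_integrand hH σ, represents_sem_den C σ _ hH⟩
  · have hH : Measurable ((Set.univ ×ˢ A : Set (State Var)).indicator (1 : State Var → ℝ≥0∞)) :=
      measurable_one.indicator (MeasurableSet.univ.prod hA)
    refine (represents_sem_den C (s, Rdb.empty) _ hH).trans (lintegral_congr fun r => ?_)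
    have hd : Rdb.Disj r Rdb.empty := Rdb.disj_empty r
    have := C.den.dens_mul_indicator_mul (fun x => A.indicator 1 x.2) (s, Rdb.empty) r
    simp only [Rdb.union_empty] at this
    rw [mul_comm]
    refine Eq.trans ?_ (this.symm.trans (by simp [hd]))
    refine congrArg (fun H => C.den.integrand H (s, Rdb.empty) r) (funext fun σ' => ?_)
    by_cases hA' : σ'.2 ∈ A <;> simp [Set.indicator, hA']
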